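/- The problem Weighted Edge Clique Partition (WECP) is the following. Input: a finite simple graph $G=(V,E)$, a weight function $w:E\to\mathbb{Z}_{>0}$, and an integer $k\ge 0$. Output: if one exists, a family $C_1,\dots,C_q$ of $q\le k$ cliques of $G$ (repetitions allowed) such that every edge $e\in E$ is contained in exactly $w(e)$ of the cliques $C_1,\dots,C_q$; otherwise the answer NO. Let $n=|V|$ and let $\beta$ be the clique number of $G$ (the size of a largest clique). Theorem. WECP, parameterized by $\beta$ and $k$, has an FPT algorithm running in $2^{\beta k\log_2 k}\,n^{O(1)}$ time (with $k\log_2 k=0$ for $k=0$). Precisely: there are a single word-RAM program and constants $c,d$ such that on every instance $(G,w,k)$, given by $n$, $k$ and the weighted adjacency matrix (with $0$ for non-edges), the program, using only words of $O(\log(n+k+\max_e w(e)+2))$ bits (every number that it computes is smaller than $(n+k+\max_e w(e)+2)^d$, with $\max_e w(e)=0$ if $E=\emptyset$), halts with a correct output after at most $2^{\beta k\log_2 k}\,(n+2)^{c}$ steps. The value of $\beta$ is not given to the program. -/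

import Mathlib

/-! ## Word RAM programs with a step count -/

namespace WordRAM

/-- A machine state: registers and a random access memory, both holding natural numbers. -/
structure State where
  reg : ℕ → ℕ
  mem : ℕ → ℕ

/-- Write the value `x` to the register `r`. -/
def State.setReg (s : State) (r x : ℕ) : State :=
  { s with reg := Function.update s.reg r x }

/-- Write the value `x` to the memory cell `a`. -/
def State.setMem (s : State) (a x : ℕ) : State :=
  { s with mem := Function.update s.mem a x }

/-- Programs in structured form. The arguments of the instructions are names of registers, except
for the literal `x` in `const r x`. A program is a finite object, so it uses finitely many
registers. -/
inductive Program where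
  /-- do nothing -/
  | skip : Program
  /-- `reg r := x` -/
  | const (r x : ℕ) : Program
  /-- `reg r := reg a + reg b` -/
  | add (r a b : ℕ) : Program
  /-- `reg r := max (reg a - reg b) 0` -/
  | sub (r a b : ℕ) : Program
  /-- `reg r := reg a * reg b` -/
  | mul (r a b : ℕ) : Program
  /-- `reg r := mem (reg a)` -/
  | load (r a : ℕ) : Program
  /-- `mem (reg a) := reg r` -/
  | store (a r : ℕ) : Program
  /-- sequential composition -/
  | seq (P Q : Program) : Program
  /-- if `reg r ≠ 0` then `P` else `Q` -/
  | branch (r : ℕ) (P Q : Program) : Program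
  /-- while `reg r ≠ 0` do `P` -/
  | loop (r : ℕ) (P : Program) : Program

/-- `Run W P s t s'`: on a machine whose words hold exactly the numbers smaller than `W`, the
program `P` started in the state `s` halts in the state `s'` after exactly `t` steps. Every
elementary instruction and every evaluation of a test is one step. There is no run through an
instruction whose result does not fit into a word. -/
inductive Run (W : ℕ) : Program → State → ℕ → State → Prop where
  | skip (s : State) : Run W .skip s 1 s
  | const (s : State) (r x : ℕ) (h : x < W) :
      Run W (.const r x) s 1 (s.setReg r x)
  | add (s : State) (r a b : ℕ) (h : s.reg a + s.reg b < W) :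
      Run W (.add r a b) s 1 (s.setReg r (s.reg a + s.reg b))
  | sub (s : State) (r a b : ℕ) (h : s.reg a - s.reg b < W) :
      Run W (.sub r a b) s 1 (s.setReg r (s.reg a - s.reg b))
  | mul (s : State) (r a b : ℕ) (h : s.reg a * s.reg b < W) :
      Run W (.mul r a b) s 1 (s.setReg r (s.reg a * s.reg b))
  | load (s : State) (r a : ℕ) (h : s.mem (s.reg a) < W) :
      Run W (.load r a) s 1 (s.setReg r (s.mem (s.reg a)))
  | store (s : State) (a r : ℕ) (h : s.reg r < W) :
      Run W (.store a r) s 1 (s.setMem (s.reg a) (s.reg r))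
  | seq {P Q : Program} {s s₁ s₂ : State} {t₁ t₂ : ℕ}
      (h₁ : Run W P s t₁ s₁) (h₂ : Run W Q s₁ t₂ s₂) :
      Run W (.seq P Q) s (t₁ + t₂) s₂
  | branch_true {r : ℕ} {P Q : Program} {s s₁ : State} {t : ℕ}
      (h : s.reg r ≠ 0) (h₁ : Run W P s t s₁) :
      Run W (.branch r P Q) s (t + 1) s₁
  | branch_false {r : ℕ} {P Q : Program} {s s₁ : State} {t : ℕ}
      (h : s.reg r = 0) (h₁ : Run W Q s t s₁) :
      Run W (.branch r P Q) s (t + 1) s₁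
  | loop_done {r : ℕ} {P : Program} {s : State} (h : s.reg r = 0) :
      Run W (.loop r P) s 1 s
  | loop_step {r : ℕ} {P : Program} {s s₁ s₂ : State} {t₁ t₂ : ℕ}
      (h : s.reg r ≠ 0) (h₁ : Run W P s t₁ s₁) (h₂ : Run W (.loop r P) s₁ t₂ s₂) :
      Run W (.loop r P) s (t₁ + t₂ + 1) s₂

end WordRAM

/-! ## Weighted Edge Clique Partition -/

/-- An instance: a graph on `n` vertices, a positive integer weight for every edge, and a
nonnegative integer `k`. -/
structure WECP where
  n : ℕ
  G : SimpleGraph (Fin n)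
  w : G.edgeSet → ℕ+
  k : ℕ

namespace WECP

/-- A family of `q` cliques (a clique may occur repeatedly) solves the instance if `q ≤ k` and every
edge lies in exactly as many members of the family as its weight says. -/
def IsSolution (I : WECP) {q : ℕ} (C : Fin q → Finset (Fin I.n)) : Prop :=
  q ≤ I.k ∧
  (∀ i, I.G.IsClique (C i : Set (Fin I.n))) ∧
  ∀ (u v : Fin I.n) (h : I.G.Adj u v),
    (Finset.univ.filter fun i => u ∈ C i ∧ v ∈ C i).card = (I.w ⟨s(u, v), h⟩ : ℕ)

open Classical in
/-- The entries of the weighted adjacency matrix; `0` stands for a non-edge. -/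
noncomputable def entry (I : WECP) (u v : Fin I.n) : ℕ :=
  if h : I.G.Adj u v then (I.w ⟨s(u, v), h⟩ : ℕ) else 0

/-- The maximum edge weight (`0` if there is no edge). -/
noncomputable def maxWeight (I : WECP) : ℕ :=
  Finset.univ.sup fun u => Finset.univ.sup fun v => I.entry u v

/-- The initial state: memory cell `0` holds `n`, cell `1` holds `k`, the cell `2 + u * n + v` holds
the entry `(u, v)` of the weighted adjacency matrix, and everything else is `0`. -/
noncomputable def input (I : WECP) : WordRAM.State where
  reg := fun _ => 0
  mem := fun a =>
    if a = 0 then I.n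
    else if a = 1 then I.k
    else if h : (a - 2) / I.n < I.n ∧ 0 < I.n then
      I.entry ⟨(a - 2) / I.n, h.1⟩ ⟨(a - 2) % I.n, Nat.mod_lt _ h.2⟩
    else 0

/-- The family of vertex sets that a final state describes: register `1` holds the number of sets,
register `2` holds an address `p`, and `v` belongs to the `i`-th set if and only if the memory cell
`p + i * n + v` is nonzero. -/
def output (n : ℕ) (s : WordRAM.State) : Fin (s.reg 1) → Finset (Fin n) :=
  fun i => Finset.univ.filter fun v => s.mem (s.reg 2 + i * n + v) ≠ 0

/-- The answer in a final state is right: either register `0` holds `1` and the family described by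
the state is a solution, or register `0` holds `0` (the answer NO) and there is no solution. -/
def IsCorrectAnswer (I : WECP) (s : WordRAM.State) : Prop :=
  (s.reg 0 = 1 ∧ I.IsSolution (output I.n s)) ∨
  (s.reg 0 = 0 ∧ ¬ ∃ (q : ℕ) (C : Fin q → Finset (Fin I.n)), I.IsSolution C)

/-- The clique number of the input graph. -/
noncomputable def β (I : WECP) : ℕ := I.G.cliqueNum

end WECP

/-! The program backtracks over families of `k` vertex sets, all empty at first. If a pair `u`, `v`
is covered less often than its weight demands, every solution extending the present family has an
index `i` whose clique contains both vertices while the present set `i` does not. The search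
therefore picks such a pair and tries all `k` indices, putting both vertices into the chosen set
(`Good.exists_slot`). A node is rejected if its move adds no vertex or if some pair is now covered
too often. When no pair is covered too often or too rarely, the family is a solution: non-edges have
weight 0, so its members are cliques (`isClique_of_feasible`).

The same argument makes all sets at an accepted node cliques, of size at most `β`. Each effective
move raises the truncated value size minus one of some set, so a path of accepted nodes has at most
`k * (β - 1)` moves (`Valid.length_le_sum`, `length_le`), and one more move may be tried and
rejected. For `k ≥ 2` the tree thus has `O(k ^ (k * (β - 1) + 1))` nodes. A node costs polynomial
time in `n` times a factor `k`, and `k * (β - 1) + 2 ≤ β * k`, so everything fits under `k ^ (β *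
k)`. The cases `k ≤ 1` are handled directly. The number `β` enters only this analysis, never the
program.

The recursion is a loop over a stack of moves. Membership is stored as a counter, so that undoing a
move is a decrement. The invariant `Search` says that in a solvable instance some solution lies at
the current node or later in the tree; the measure `stepsFrom` bounds the remaining iterations.
Loop-free code is verified by weakest preconditions, loops by `Halts.countdown` and
`Halts.loop_measure`. -/

namespace WordRAM

/-! ### Program logic with time bounds. -/

@[simp] theorem State.setReg_reg (s : State) (r x q : ℕ) :
    (s.setReg r x).reg q = if q = r then x else s.reg q := by
  simp [State.setReg, Function.update_apply]

@[simp] theorem State.setReg_mem (s : State) (r x : ℕ) : (s.setReg r x).mem = s.mem := rfl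

@[simp] theorem State.setMem_reg (s : State) (a x : ℕ) : (s.setMem a x).reg = s.reg := rfl

@[simp] theorem State.setMem_mem (s : State) (a x b : ℕ) :
    (s.setMem a x).mem b = if b = a then x else s.mem b := by
  simp [State.setMem, Function.update_apply]

/-- A bound for the number of steps of a program without loops. -/
def Program.cost : Program → ℕ
  | .seq P Q => P.cost + Q.cost
  | .branch _ P Q => P.cost + Q.cost + 1
  | _ => 1

/-- The weakest precondition of a program without loops. -/
def Program.wp (W : ℕ) : Program → (State → Prop) → State → Prop
  | .skip, Q, s => Q s
  | .const r x, Q, s => x < W ∧ Q (s.setReg r x)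
  | .add r a b, Q, s => s.reg a + s.reg b < W ∧ Q (s.setReg r (s.reg a + s.reg b))
  | .sub r a b, Q, s => s.reg a - s.reg b < W ∧ Q (s.setReg r (s.reg a - s.reg b))
  | .mul r a b, Q, s => s.reg a * s.reg b < W ∧ Q (s.setReg r (s.reg a * s.reg b))
  | .load r a, Q, s => s.mem (s.reg a) < W ∧ Q (s.setReg r (s.mem (s.reg a)))
  | .store a r, Q, s => s.reg r < W ∧ Q (s.setMem (s.reg a) (s.reg r))
  | .seq P R, Q, s => P.wp W (R.wp W Q) s
  | .branch r P R, Q, s => (s.reg r ≠ 0 → P.wp W Q s) ∧ (s.reg r = 0 → R.wp W Q s)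
  | .loop _ _, _, _ => False

/-- Total correctness: started in `s`, the program halts within `T` steps in a state with `Q`. -/
def Halts (W : ℕ) (P : Program) (T : ℕ) (Q : State → Prop) (s : State) : Prop :=
  ∃ t ≤ T, ∃ s', Run W P s t s' ∧ Q s'

variable {W : ℕ}

theorem Halts.mono {P : Program} {T T' : ℕ} {Q Q' : State → Prop} {s : State}
    (h : Halts W P T Q s) (hT : T ≤ T') (hQ : ∀ s', Q s' → Q' s') : Halts W P T' Q' s := by
  obtain ⟨t, ht, s', hr, hq⟩ := h
  exact ⟨t, ht.trans hT, s', hr, hQ _ hq⟩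

theorem Halts.seq {P R : Program} {T₁ T₂ : ℕ} {Q₁ Q₂ : State → Prop} {s : State}
    (h₁ : Halts W P T₁ Q₁ s) (h₂ : ∀ s', Q₁ s' → Halts W R T₂ Q₂ s') :
    Halts W (.seq P R) (T₁ + T₂) Q₂ s := by
  obtain ⟨t, ht, s', hr, hq⟩ := h₁
  obtain ⟨t', ht', s'', hr', hq'⟩ := h₂ _ hq
  exact ⟨t + t', by omega, s'', .seq hr hr', hq'⟩

theorem Halts.branch {r : ℕ} {P R : Program} {T : ℕ} {Q : State → Prop} {s : State}
    (h₁ : s.reg r ≠ 0 → Halts W P T Q s) (h₂ : s.reg r = 0 → Halts W R T Q s) :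
    Halts W (.branch r P R) (T + 1) Q s := by
  by_cases h : s.reg r = 0
  · obtain ⟨t, ht, s', hr, hq⟩ := h₂ h
    exact ⟨t + 1, by omega, s', .branch_false h hr, hq⟩
  · obtain ⟨t, ht, s', hr, hq⟩ := h₁ h
    exact ⟨t + 1, by omega, s', .branch_true h hr, hq⟩

/-- The bridge from symbolic execution to runs. A branch is charged for both alternatives, so `cost`
does not depend on the state and can be evaluated by `decide`. -/
theorem Program.wp.halts {P : Program} {Q : State → Prop} {s : State}
    (h : P.wp W Q s) : Halts W P P.cost Q s := by
  induction P generalizing Q s with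
  | skip => exact ⟨1, le_rfl, _, .skip s, h⟩
  | const r x => exact ⟨1, le_rfl, _, .const s r x h.1, h.2⟩
  | add r a b => exact ⟨1, le_rfl, _, .add s r a b h.1, h.2⟩
  | sub r a b => exact ⟨1, le_rfl, _, .sub s r a b h.1, h.2⟩
  | mul r a b => exact ⟨1, le_rfl, _, .mul s r a b h.1, h.2⟩
  | load r a => exact ⟨1, le_rfl, _, .load s r a h.1, h.2⟩
  | store a r => exact ⟨1, le_rfl, _, .store s a r h.1, h.2⟩
  | seq P R ihP ihR => exact (ihP h).seq fun s' hs' => ihR hs'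
  | branch r P R ihP ihR =>
    exact Halts.branch (fun hr => (ihP (h.1 hr)).mono (Nat.le_add_right _ _) fun _ => id)
      (fun hr => (ihR (h.2 hr)).mono (Nat.le_add_left _ _) fun _ => id)
  | loop r P => exact h.elim

/-- A loop whose control register counts down. -/
theorem Halts.countdown {r : ℕ} {P : Program} {T : ℕ} {I : ℕ → State → Prop}
    (hr : ∀ j s, I j s → s.reg r = j)
    (hP : ∀ j s, I (j + 1) s → Halts W P T (I j) s) (j : ℕ) (s : State) (h : I j s) :
    Halts W (.loop r P) (j * (T + 1) + 1) (I 0) s := by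
  induction j generalizing s with
  | zero => exact ⟨1, by omega, s, .loop_done (hr _ _ h), h⟩
  | succ j ih =>
    obtain ⟨t, ht, s', hrun, hq⟩ := hP j s h
    obtain ⟨t', ht', s'', hrun', hq'⟩ := ih s' hq
    refine ⟨t + t' + 1, ?_, s'', .loop_step (by rw [hr _ _ h]; omega) hrun hrun', hq'⟩
    rw [Nat.succ_mul]; omega

/-- A loop with a state invariant indexed by `α` and a measure that every iteration decreases;
`Q` holds where the loop is left. -/
theorem Halts.loop_measure {α : Type*} {r : ℕ} {P : Program} {T : ℕ} {I : α → State → Prop}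
    {Q : State → Prop} (μ : α → ℕ)
    (hr : ∀ a s, I a s → s.reg r ≠ 0) (hQ : ∀ s, Q s → s.reg r = 0)
    (hP : ∀ a s, I a s → Halts W P T (fun s' => Q s' ∨ ∃ b, μ b < μ a ∧ I b s') s)
    (a : α) (s : State) (h : I a s) :
    Halts W (.loop r P) ((μ a + 1) * (T + 1) + 1) Q s := by
  induction hm : μ a using Nat.strong_induction_on generalizing a s with
  | _ m ih =>
    obtain ⟨t, ht, s', hrun, hq⟩ := hP a s h
    rcases hq with hq | ⟨b, hb, hI⟩
    · refine ⟨t + 1 + 1, ?_, s', .loop_step (hr _ _ h) hrun (.loop_done (hQ _ hq)), hq⟩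
      nlinarith
    · obtain ⟨t', ht', s'', hrun', hq'⟩ := ih _ (hm ▸ hb) b s' hI rfl
      refine ⟨t + t' + 1, ?_, s'', .loop_step (hr _ _ h) hrun hrun', hq'⟩
      have : (μ b + 1) * (T + 1) ≤ m * (T + 1) := Nat.mul_le_mul_right _ (by omega)
      rw [Nat.succ_mul]; omega

end WordRAM

/-! ## The search tree -/

namespace CliqueSearch

open Finset

/-- The decision to put the vertices `fst` and `snd` into the clique number `slot`. -/
structure Move where
  slot : ℕ
  fst : ℕ
  snd : ℕ

/-- The same decision for the clique number `i`. -/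
def Move.withSlot (t : Move) (i : ℕ) : Move := ⟨i, t.fst, t.snd⟩

/-- How many moves put the vertex `x` into the clique number `i`. -/
def cnt : List Move → ℕ → ℕ → ℕ
  | [], _, _ => 0
  | t :: b, i, x => cnt b i x + if i = t.slot ∧ (x = t.fst ∨ x = t.snd) then 1 else 0

/-- How many of the first `k` sets contain both `u` and `v`; the vertex `x` belongs to the `i`-th
set if `f i x ≠ 0`. -/
def cov (k : ℕ) (f : ℕ → ℕ → ℕ) (u v : ℕ) : ℕ :=
  ((range k).filter fun i => f i u ≠ 0 ∧ f i v ≠ 0).card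

/-- The family covers every pair exactly as often as `e` demands. -/
def Solves (n k : ℕ) (e f : ℕ → ℕ → ℕ) : Prop :=
  ∀ u < n, ∀ v < u, cov k f u v = e u v

/-- No pair is covered more often than `e` allows. -/
def Feasible (n k : ℕ) (e f : ℕ → ℕ → ℕ) : Prop :=
  ∀ u < n, ∀ v < u, cov k f u v ≤ e u v

/-- The last move has no effect. -/
def Idle : List Move → Prop
  | [] => False
  | t :: b => cnt b t.slot t.fst ≠ 0 ∧ cnt b t.slot t.snd ≠ 0

/-- Every move has an effect and leads to a feasible family. -/
def Valid (n k : ℕ) (e : ℕ → ℕ → ℕ) : List Move → Prop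
  | [] => True
  | t :: b => Valid n k e b ∧ t.slot < k ∧ t.snd < t.fst ∧ t.fst < n ∧ ¬ Idle (t :: b) ∧
      Feasible n k e (cnt (t :: b))

/-- The sequences of at most `M` moves that the search visits. -/
def Pending (n k M : ℕ) (e : ℕ → ℕ → ℕ) : List Move → Prop
  | [] => True
  | t :: b => Valid n k e b ∧ t.slot ≤ k ∧ t.snd < t.fst ∧ t.fst < n ∧ b.length + 1 ≤ M

/-- Some solution contains all the moves, and the last one has an effect. -/
def Good (n k : ℕ) (e : ℕ → ℕ → ℕ) (a : List Move) : Prop :=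
  ∃ f, Solves n k e f ∧ (∀ i < k, ∀ x, cnt a i x ≠ 0 → f i x ≠ 0) ∧ ¬ Idle a

/-- Some solution lies in the part of the search tree after the subtree of the given node. -/
def Later (n k : ℕ) (e : ℕ → ℕ → ℕ) : List Move → Prop
  | [] => False
  | t :: b => (∃ i, t.slot + 1 ≤ i ∧ i < k ∧ Good n k e (t.withSlot i :: b)) ∨ Later n k e b

/-- Some solution lies in the part of the search tree from the given node on. -/
def Ahead (n k : ℕ) (e : ℕ → ℕ → ℕ) : List Move → Prop
  | [] => Good n k e []
  | t :: b => (∃ i, t.slot ≤ i ∧ i < k ∧ Good n k e (t.withSlot i :: b)) ∨ Later n k e b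

/-- The number of steps for a subtree of height `m`. -/
def treeSize (k : ℕ) : ℕ → ℕ
  | 0 => 1
  | m + 1 => k * treeSize k m + 2

/-- The number of steps after the subtree of a node. -/
def stepsAfter (k M : ℕ) : List Move → ℕ
  | [] => 0
  | t :: b => (k - (t.slot + 1)) * treeSize k (M - (b.length + 1)) + 1 + stepsAfter k M b

/-- The number of steps from a node on. -/
def stepsFrom (k M : ℕ) : List Move → ℕ
  | [] => treeSize k M
  | t :: b => (k - t.slot) * treeSize k (M - (b.length + 1)) + 1 + stepsAfter k M b

/-- The invariant of the search. -/
def Search (n k M : ℕ) (e : ℕ → ℕ → ℕ) (a : List Move) : Prop :=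
  Pending n k M e a ∧ ((∃ f, Solves n k e f) → Ahead n k e a)

variable {n k M : ℕ} {e : ℕ → ℕ → ℕ}

/-! ### Exhaustiveness of the search. -/

theorem cov_mono {f g : ℕ → ℕ → ℕ} (h : ∀ i < k, ∀ x, f i x ≠ 0 → g i x ≠ 0) (u v : ℕ) :
    cov k f u v ≤ cov k g u v := by
  refine card_le_card fun i hi => ?_
  simp only [mem_filter, mem_range] at hi ⊢
  exact ⟨hi.1, h i hi.1 _ hi.2.1, h i hi.1 _ hi.2.2⟩

theorem cov_succ (j : ℕ) (f : ℕ → ℕ → ℕ) (u v : ℕ) :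
    cov (j + 1) f u v = cov j f u v + if f j u ≠ 0 ∧ f j v ≠ 0 then 1 else 0 := by
  unfold cov
  rw [range_add_one, filter_insert]
  split_ifs <;> simp

theorem cnt_le_length (a : List Move) (i x : ℕ) : cnt a i x ≤ a.length := by
  induction a with
  | nil => simp [cnt]
  | cons t b ih =>
    simp only [cnt, List.length_cons]
    split_ifs <;> omega

theorem treeSize_pos (k m : ℕ) : 0 < treeSize k m := by
  cases m <;> simp [treeSize]

theorem Good.feasible {a : List Move} (h : Good n k e a) : Feasible n k e (cnt a) := by
  obtain ⟨f, hf, hfa, -⟩ := h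
  intro u hu v hv
  rw [← hf u hu v hv]
  exact cov_mono hfa u v

/-- The solution covers the pair more often than the moves do, so by counting some index covers it
only in the solution. That index gives a move which stays inside the solution and is not idle. -/
theorem Good.exists_slot {a : List Move} (h : Good n k e a) {u v : ℕ} (hv : v < u) (hu : u < n)
    (hlt : cov k (cnt a) u v < e u v) : ∃ i < k, Good n k e (⟨i, u, v⟩ :: a) := by
  obtain ⟨f, hf, hfa, -⟩ := h
  rw [← hf u hu v hv] at hlt
  obtain ⟨i, hi, hia⟩ := exists_mem_notMem_of_card_lt_card hlt
  simp only [mem_filter, mem_range] at hi hia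
  refine ⟨i, hi.1, f, hf, fun j hj x hx => ?_, fun h => hia ⟨hi.1, h⟩⟩
  simp only [cnt] at hx
  by_cases hjx : j = i ∧ (x = u ∨ x = v)
  · obtain ⟨rfl, rfl | rfl⟩ := hjx
    exacts [hi.2.1, hi.2.2]
  · simp only [hjx, if_false, add_zero] at hx
    exact hfa j hj x hx

theorem Search.nil : Search n k M e [] :=
  ⟨trivial, fun ⟨f, hf⟩ => ⟨f, hf, fun _ _ _ h => (h rfl).elim, id⟩⟩

theorem Search.length_le {a : List Move} (h : Search n k M e a) : a.length ≤ M := by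
  cases a with
  | nil => simp
  | cons t b => exact h.1.2.2.2.2

theorem Search.not_solvable {t : Move} (h : Search n k M e [t]) (ht : t.slot = k) :
    ¬ ∃ f, Solves n k e f := by
  intro hs
  rcases h.2 hs with ⟨i, hi, hik, -⟩ | hl
  · omega
  · exact hl

theorem Valid.pending_withSlot {t : Move} {b : List Move} (h : Valid n k e (t :: b))
    (hl : b.length + 1 ≤ M) : Pending n k M e (t.withSlot (t.slot + 1) :: b) :=
  ⟨h.1, h.2.1, h.2.2.1, h.2.2.2.1, hl⟩

/-- With the slot at `k`, the first alternative of `Ahead` is void, and `Later` for the remaining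
stack unfolds to `Ahead` for the next sibling of `t'`. -/
theorem Search.pop {t t' : Move} {b : List Move} (h : Search n k M e (t :: t' :: b))
    (ht : t.slot = k) : Search n k M e (t'.withSlot (t'.slot + 1) :: b) := by
  refine ⟨h.1.1.pending_withSlot ?_, fun hs => ?_⟩
  · have := h.length_le
    simp only [List.length_cons] at this
    omega
  · rcases h.2 hs with ⟨i, hi, hik, -⟩ | hl
    · omega
    · exact hl

theorem Search.fail {t : Move} {b : List Move} (h : Search n k M e (t :: b)) (ht : t.slot < k)
    (hbad : Idle (t :: b) ∨ ¬ Feasible n k e (cnt (t :: b))) :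
    Search n k M e (t.withSlot (t.slot + 1) :: b) := by
  refine ⟨⟨h.1.1, ht, h.1.2.2⟩, fun hs => ?_⟩
  rcases h.2 hs with ⟨i, hi, hik, hg⟩ | hl
  · rcases hi.eq_or_lt with rfl | hi
    · exact (hbad.elim (fun hb => hg.choose_spec.2.2 hb) (fun hb => hb hg.feasible)).elim
    · exact .inl ⟨i, hi, hik, hg⟩
  · exact .inr hl

theorem Search.valid {a : List Move} (h : Search n k M e a) (hslot : ∀ t ∈ a.head?, t.slot < k)
    (hidle : ¬ Idle a) (hf : Feasible n k e (cnt a)) : Valid n k e a := by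
  cases a with
  | nil => trivial
  | cons t b => exact ⟨h.1.1, hslot t rfl, h.1.2.2.1, h.1.2.2.2.1, hidle, hf⟩

/-- A solution promised at the current node passes to one of its children; a solution promised later
stays later. Whichever undercovered pair is chosen, no solution is lost. -/
theorem Search.push {a : List Move} (h : Search n k M e a) (ha : Valid n k e a)
    (hl : a.length + 1 ≤ M) {u v : ℕ} (hv : v < u) (hu : u < n)
    (hlt : cov k (cnt a) u v < e u v) : Search n k M e (⟨0, u, v⟩ :: a) := by
  refine ⟨⟨ha, Nat.zero_le _, hv, hu, hl⟩, fun hs => ?_⟩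
  have key : Good n k e a → Ahead n k e (⟨0, u, v⟩ :: a) := fun hg => by
    obtain ⟨i, hi, hgi⟩ := hg.exists_slot hv hu hlt
    exact .inl ⟨i, Nat.zero_le _, hi, hgi⟩
  have ahead := h.2 hs
  cases a with
  | nil => exact key ahead
  | cons t b =>
    rcases ahead with ⟨i, hi, hik, hg⟩ | hl
    · rcases hi.eq_or_lt with rfl | hi
      · exact key hg
      · exact .inr (.inl ⟨i, hi, hik, hg⟩)
    · exact .inr (.inr hl)

/-! ### The termination measure and the depth of the search. -/

theorem stepsFrom_pop {t t' : Move} {b : List Move} :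
    stepsFrom k M (t'.withSlot (t'.slot + 1) :: b) < stepsFrom k M (t :: t' :: b) := by
  simp only [stepsFrom, stepsAfter, Move.withSlot]
  omega

theorem stepsFrom_fail {t : Move} {b : List Move} (ht : t.slot < k) :
    stepsFrom k M (t.withSlot (t.slot + 1) :: b) < stepsFrom k M (t :: b) := by
  simp only [stepsFrom, Move.withSlot]
  have := treeSize_pos k (M - (b.length + 1))
  have : (k - (t.slot + 1)) * treeSize k (M - (b.length + 1)) <
      (k - t.slot) * treeSize k (M - (b.length + 1)) :=
    Nat.mul_lt_mul_of_pos_right (by omega) this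
  omega

/-- Of the 2 in `treeSize`, one unit pays for visiting the node and one for the later state in which
the slot of its children has reached `k`. -/
theorem stepsFrom_push {a : List Move} (ha : ∀ t ∈ a.head?, t.slot < k) (hl : a.length + 1 ≤ M)
    {u v : ℕ} : stepsFrom k M (⟨0, u, v⟩ :: a) < stepsFrom k M a := by
  obtain ⟨m, rfl⟩ := Nat.exists_eq_add_of_le hl
  cases a with
  | nil =>
    have hm : 1 + m = m + 1 := by omega
    simp [stepsFrom, stepsAfter, treeSize, hm]
  | cons t b =>
    have ht : t.slot < k := ha t rfl
    have h₁ : (t :: b).length + 1 + m - ((t :: b).length + 1) = m := by omega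
    have h₂ : (t :: b).length + 1 + m - (b.length + 1) = m + 1 := by
      simp only [List.length_cons]; omega
    have h₃ : k - t.slot = k - (t.slot + 1) + 1 := by omega
    simp only [stepsFrom, stepsAfter, h₁, h₂, h₃, treeSize, Nat.add_mul, Nat.sub_zero]
    omega

/-- The number of vertices in the clique number `i`. -/
def size (n : ℕ) (a : List Move) (i : ℕ) : ℕ := ((range n).filter fun x => cnt a i x ≠ 0).card

/-- After a move its set has at least two vertices, and a move that is not idle enlarges it. Hence
the truncated value size minus one grows strictly, even for an empty set, which jumps from size 0 to
2. -/
theorem Valid.length_le_sum {a : List Move} (h : Valid n k e a) :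
    a.length ≤ ∑ i ∈ range k, (size n a i - 1) := by
  induction a with
  | nil => simp
  | cons t b ih =>
    obtain ⟨hb, ht, hvu, hun, hidle, -⟩ := h
    refine (Nat.succ_le_succ (ih hb)).trans (Nat.succ_le_of_lt ?_)
    have hsub : ∀ i, ((range n).filter fun x => cnt b i x ≠ 0) ⊆
        ((range n).filter fun x => cnt (t :: b) i x ≠ 0) := fun i x hx => by
      obtain ⟨hxn, hx⟩ := mem_filter.1 hx
      exact mem_filter.2 ⟨hxn, by simp only [cnt]; omega⟩
    refine sum_lt_sum (fun i _ => Nat.sub_le_sub_right (card_le_card (hsub i)) 1)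
      ⟨t.slot, mem_range.2 ht, ?_⟩
    have hmem : ∀ x, x = t.fst ∨ x = t.snd →
        x ∈ (range n).filter fun x => cnt (t :: b) t.slot x ≠ 0 := fun x hx => by
      refine mem_filter.2 ⟨mem_range.2 (by omega), ?_⟩
      simp only [cnt, hx, and_self, if_true]
      omega
    have h₂ : 2 ≤ size n (t :: b) t.slot := by
      refine Nat.succ_le_of_lt (one_lt_card.2
        ⟨_, hmem _ (.inl rfl), _, hmem _ (.inr rfl), by omega⟩)
    have h₁ : size n b t.slot < size n (t :: b) t.slot := by
      refine card_lt_card ((hsub _).ssubset_of_ne fun heq => hidle ?_)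
      have hf := hmem _ (.inl rfl)
      have hs := hmem _ (.inr rfl)
      rw [← heq] at hf hs
      exact ⟨(mem_filter.1 hf).2, (mem_filter.1 hs).2⟩
    omega

theorem Valid.feasible {a : List Move} (h : Valid n k e a) : Feasible n k e (cnt a) := by
  cases a with
  | nil => intro u _ v _; simp [cov, cnt]
  | cons t b => exact h.2.2.2.2.2

/-- The summand 2 strengthens the induction hypothesis: the step then needs only `4 ≤ 2 * k`. -/
theorem treeSize_le (hk : 2 ≤ k) (m : ℕ) : treeSize k m + 2 ≤ 3 * k ^ m := by
  induction m with
  | zero => simp [treeSize]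
  | succ m ih =>
    simp only [treeSize, pow_succ]
    nlinarith

theorem treeSize_one (m : ℕ) : treeSize 1 m = 2 * m + 1 := by
  induction m with
  | zero => rfl
  | succ m ih => simp only [treeSize, ih]; ring

theorem treeSize_zero (m : ℕ) : treeSize 0 m ≤ 2 := by
  cases m <;> simp [treeSize]

end CliqueSearch

/-! ## The program

Constant registers: `1` holds `k`, `2` the address of the family, `3` holds `n`, `4` the address of
the stack, `6`, `7`, `27`, `28` hold the numbers `1`, `3`, `2`, `0`. Register `5` is the stack
pointer, `8` is nonzero while the search is running. A move is handed over in the registers `10`,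
`11`, `12`. The registers `13`, `14`, `15` are flags: the slot of the last move is out of range, the
family is to be rejected, the pair in the registers `16`, `17` is covered too rarely. The registers
`18` to `26` are for temporary use. -/

namespace CliqueSearch

open WordRAM Program Finset

/-- Load the last move. -/
def loadTop : Program :=
  .seq (.sub 26 5 7) <| .seq (.load 10 26) <| .seq (.add 26 26 6) <| .seq (.load 11 26) <|
  .seq (.add 26 26 6) (.load 12 26)

/-- Compute the addresses of the two cells of a move. -/
def address (i u v : ℕ) : Program :=
  .seq (.mul 18 i 3) <| .seq (.add 18 18 2) <| .seq (.add 19 18 v) (.add 18 18 u)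

/-- Increment the two cells of a move. -/
def apply : Program :=
  .seq (address 10 11 12) <|
  .seq (.load 20 18) <| .seq (.add 20 20 6) <| .seq (.store 18 20) <|
  .seq (.load 20 19) <| .seq (.add 20 20 6) (.store 19 20)

/-- Decrement the two cells of a move. -/
def undo : Program :=
  .seq (address 10 11 12) <|
  .seq (.load 20 18) <| .seq (.sub 20 20 6) <| .seq (.store 18 20) <|
  .seq (.load 20 19) <| .seq (.sub 20 20 6) (.store 19 20)

/-- Put the slot of the move in the registers into the last move on the stack. -/
def storeSlot : Program :=
  .seq (.add 10 10 6) <| .seq (.sub 26 5 7) (.store 26 10)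

/-- Replace the last move by the next one. -/
def bump : Program :=
  .seq loadTop <| .seq undo <| .seq storeSlot apply

/-- Drop the last move and replace the one before it by the next one. -/
def pop : Program :=
  .seq loadTop <| .seq undo <| .seq (.seq (.sub 5 5 7) (.sub 26 5 4)) <|
  .branch 26 bump (.seq (.const 8 0) (.const 0 0))

/-- Put a move on the stack, without its effect on the family. -/
def pushStack : Program :=
  .seq (.const 10 0) <| .seq (.add 11 16 28) <| .seq (.add 12 17 28) <|
  .seq (.store 5 10) <| .seq (.add 26 5 6) <| .seq (.store 26 11) <| .seq (.add 26 26 6) <|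
  .seq (.store 26 12) (.add 5 5 7)

/-- Append a move. -/
def push : Program := .seq pushStack apply

/-- Check whether the slot in register `10` is out of range. -/
def testSlot : Program :=
  .seq (.sub 26 1 10) (.branch 26 .skip (.const 13 1))

/-- Set the flags according to the last move. -/
def test : Program :=
  .seq (.const 13 0) <| .seq (.const 14 0) <| .seq (.const 15 0) <| .seq (.sub 26 5 4) <|
  .branch 26
    (.seq loadTop <| .seq (address 10 11 12) <|
      .seq (.load 20 18) <| .seq (.load 21 19) <| .seq (.sub 20 20 6) <| .seq (.sub 21 21 6) <|
      .seq (.branch 20 (.branch 21 (.const 14 1) .skip) .skip) testSlot)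
    .skip

/-- Count the set with the number in register `24` if it contains the pair. -/
def countStep : Program :=
  .seq (.sub 24 24 6) <| .seq (address 24 22 23) <|
  .seq (.load 20 18) <| .seq (.load 21 19) <|
  .branch 20 (.branch 21 (.add 25 25 6) .skip) .skip

/-- Compare the number of sets that contain the pair with the entry of the matrix. -/
def compare : Program :=
  .seq (.mul 26 22 3) <| .seq (.add 26 26 27) <| .seq (.add 26 26 23) <| .seq (.load 26 26) <|
  .seq (.sub 20 25 26) <| .seq (.branch 20 (.const 14 1) .skip) <|
  .seq (.sub 20 26 25)
    (.branch 20 (.seq (.const 15 1) <| .seq (.add 16 22 28) (.add 17 23 28)) .skip)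

/-- Check one pair. -/
def pairStep : Program :=
  .seq (.seq (.sub 23 23 6) <| .seq (.const 25 0) (.add 24 1 28)) <|
  .seq (.loop 24 countStep) compare

/-- Check the pairs of a vertex with all smaller ones. -/
def rowStep : Program :=
  .seq (.seq (.sub 22 22 6) (.add 23 22 28)) (.loop 23 pairStep)

/-- Check all pairs. -/
def scan : Program := .seq (.add 22 3 28) (.loop 22 rowStep)

/-- One step of the search. -/
def searchStep : Program :=
  .seq test <| .branch 13 pop <| .seq scan <|
  .branch 14 bump <| .branch 15 push <| .seq (.const 8 0) (.const 0 1)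

/-- Set up the registers. -/
def init : Program :=
  .seq (.const 6 1) <| .seq (.const 27 2) <| .seq (.const 7 3) <| .seq (.load 3 28) <|
  .seq (.load 1 6) <| .seq (.mul 2 3 3) <| .seq (.add 2 2 27) <| .seq (.mul 4 1 3) <|
  .seq (.add 4 4 3) <| .seq (.add 4 4 2) <| .seq (.add 5 4 28) (.const 8 1)

/-- The whole program. -/
def main : Program := .seq init (.loop 8 searchStep)

/-! ## Memory -/

/-- The address of the stack. -/
def stackBase (n k : ℕ) : ℕ := k * n + n + (n * n + 2)

/-- The stack holds the moves. -/
def Stack (m : ℕ → ℕ) (p : ℕ) : List Move → Prop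
  | [] => True
  | t :: b => m (p + 3 * b.length) = t.slot ∧ m (p + 3 * b.length + 1) = t.fst ∧
      m (p + 3 * b.length + 2) = t.snd ∧ Stack m p b

/-- The memory holds the matrix `e`, the family `f` and the stack `a`. -/
structure Memory (n k : ℕ) (e f : ℕ → ℕ → ℕ) (a : List Move) (m : ℕ → ℕ) : Prop where
  matrix : ∀ u < n, ∀ v < n, m (u * n + 2 + v) = e u v
  family : ∀ i ≤ k, ∀ u < n, m (i * n + (n * n + 2) + u) = f i u
  stack : Stack m (stackBase n k) a

/-- The constant registers. -/
structure Registers (n k : ℕ) (s : State) : Prop where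
  r1 : s.reg 1 = k
  r2 : s.reg 2 = n * n + 2
  r3 : s.reg 3 = n
  r4 : s.reg 4 = stackBase n k
  r6 : s.reg 6 = 1
  r7 : s.reg 7 = 3
  r27 : s.reg 27 = 2
  r28 : s.reg 28 = 0

variable {W n k M : ℕ} {e f : ℕ → ℕ → ℕ} {a b : List Move} {m : ℕ → ℕ}

theorem mul_add_inj {i j u v : ℕ} (hu : u < n) (hv : v < n) :
    i * n + u = j * n + v ↔ i = j ∧ u = v := by
  refine ⟨fun h => ?_, fun h => by rw [h.1, h.2]⟩
  have h₁ := congrArg (· / n) h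
  have h₂ := congrArg (· % n) h
  have hn : 0 < n := by omega
  simp only [mul_comm _ n, Nat.mul_add_div hn, Nat.mul_add_mod, Nat.div_eq_of_lt hu,
    Nat.div_eq_of_lt hv, Nat.mod_eq_of_lt hu, Nat.mod_eq_of_lt hv, add_zero] at h₁ h₂
  exact ⟨h₁, h₂⟩

theorem family_address_inj {i j u v : ℕ} (hu : u < n) (hv : v < n) :
    i * n + (n * n + 2) + u = j * n + (n * n + 2) + v ↔ i = j ∧ u = v := by
  rw [← mul_add_inj (i := i) (j := j) hu hv]
  omega

/-- The family occupies `k + 1` rows. Row `k` is a spare one: a move is applied before its slot is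
found to be out of range, and `cov k` never reads that row. -/
theorem family_address_lt {i u : ℕ} (hi : i ≤ k) (hu : u < n) :
    i * n + (n * n + 2) + u < stackBase n k := by
  have := Nat.mul_le_mul_right n hi
  unfold stackBase
  omega

theorem matrix_address_lt {u v : ℕ} (hu : u < n) (hv : v < n) : u * n + 2 + v < n * n + 2 := by
  have := Nat.mul_le_mul_right n (Nat.succ_le_of_lt hu)
  rw [Nat.succ_mul] at this
  omega

theorem Stack.congr {m m' : ℕ → ℕ} {p : ℕ} (h : Stack m p a)
    (hm : ∀ x, p ≤ x → x < p + 3 * a.length → m' x = m x) : Stack m' p a := by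
  induction a with
  | nil => trivial
  | cons t b ih =>
    simp only [List.length_cons] at hm
    obtain ⟨h₁, h₂, h₃, h₄⟩ := h
    refine ⟨?_, ?_, ?_, ih h₄ fun x hx hx' => hm x hx (by omega)⟩
    · rw [hm _ (by omega) (by omega), h₁]
    · rw [hm _ (by omega) (by omega), h₂]
    · rw [hm _ (by omega) (by omega), h₃]

theorem Memory.congr_family (h : Memory n k e f a m) {f' : ℕ → ℕ → ℕ}
    (hf : ∀ i x, f i x = f' i x) : Memory n k e f' a m :=
  ⟨h.matrix, fun i hi u hu => (h.family i hi u hu).trans (hf i u), h.stack⟩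

theorem Memory.setFamily (h : Memory n k e f a m) {i u x : ℕ} (hi : i ≤ k) (hu : u < n)
    {m' : ℕ → ℕ} (hm : ∀ y, m' y = if y = i * n + (n * n + 2) + u then x else m y) :
    Memory n k e (fun j v => if j = i ∧ v = u then x else f j v) a m' := by
  refine ⟨fun u' hu' v' hv' => ?_, fun j hj v hv => ?_, h.stack.congr fun y hy _ => ?_⟩
  · have := matrix_address_lt hu' hv'
    rw [hm, if_neg (by omega), h.matrix u' hu' v' hv']
  · rw [hm, h.family j hj v hv]
    simp only [family_address_inj hv hu]
  · have := family_address_lt hi hu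
    rw [hm, if_neg (by omega)]

theorem Memory.of_stack (h : Memory n k e f a m) {m' : ℕ → ℕ}
    (hm : ∀ y < stackBase n k, m' y = m y) (hs : Stack m' (stackBase n k) b) :
    Memory n k e f b m' := by
  refine ⟨fun u hu v hv => ?_, fun i hi u hu => ?_, hs⟩
  · have := matrix_address_lt hu hv
    rw [hm _ (by unfold stackBase; omega), h.matrix u hu v hv]
  · rw [hm _ (family_address_lt hi hu), h.family i hi u hu]

/-- The assumptions on the word size. -/
structure WordSize (W n k M : ℕ) (e : ℕ → ℕ → ℕ) : Prop where
  large : stackBase n k + 3 * M + k + 10 ≤ W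
  entry : ∀ u v, e u v < W

/-- Two states agree in all registers but the temporary ones. -/
def Agree (s s' : State) : Prop := ∀ r, (r < 10 ∨ 26 < r) → s'.reg r = s.reg r

theorem Registers.of_agree {s s' : State} (h : Registers n k s) (hs : Agree s s') :
    Registers n k s' := by
  constructor <;> rw [hs _ (by decide)]
  exacts [h.r1, h.r2, h.r3, h.r4, h.r6, h.r7, h.r27, h.r28]

/-- The effect of a move on the family. -/
def addMove (f : ℕ → ℕ → ℕ) (i u v : ℕ) : ℕ → ℕ → ℕ :=
  fun j x => f j x + if j = i ∧ (x = u ∨ x = v) then 1 else 0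

/-- The registers 18 and 19 are written before `ru` and `rv` are read for the last time, so these
must be different registers; `ri` is read first and may be any. -/
theorem wp_address (hW : WordSize W n k M e) {s : State} (hs : Registers n k s) {ri ru rv : ℕ}
    (hru : 20 ≤ ru ∨ ru < 18) (hrv : 20 ≤ rv ∨ rv < 18)
    (hi : s.reg ri ≤ k) (hu : s.reg ru < n) (hv : s.reg rv < n) {Q : State → Prop}
    (h : ∀ s', (∀ r, r ≠ 18 → r ≠ 19 → s'.reg r = s.reg r) → s'.mem = s.mem →
      s'.reg 18 = s.reg ri * n + (n * n + 2) + s.reg ru →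
      s'.reg 19 = s.reg ri * n + (n * n + 2) + s.reg rv → Q s') :
    (address ri ru rv).wp W Q s := by
  have h₁ := family_address_lt hi hu
  have h₂ := family_address_lt hi hv
  have h₃ := hW.large
  have hu18 : ru ≠ 18 := by omega
  have hv18 : rv ≠ 18 := by omega
  have hu19 : ru ≠ 19 := by omega
  simp only [address, Program.wp, State.setReg_reg, hs.r3, hs.r2, hu18, hv18, hu19, if_true,
    if_false, Nat.reduceEqDiff]
  refine ⟨by omega, by omega, by omega, by omega, h _ (fun r h₁ h₂ => ?_) rfl ?_ ?_⟩
  · simp [h₁, h₂]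
  · simp
  · simp

theorem wp_loadTop (hW : WordSize W n k M e) {s : State} (hs : Registers n k s) {t : Move}
    (hm : Memory n k e f (t :: b) s.mem) (hsp : s.reg 5 = stackBase n k + 3 * (b.length + 1))
    (hl : b.length + 1 ≤ M) (ht : t.slot ≤ k) (hv : t.snd < t.fst) (hu : t.fst < n)
    {Q : State → Prop}
    (h : ∀ s', (∀ r, r ≠ 10 → r ≠ 11 → r ≠ 12 → r ≠ 26 → s'.reg r = s.reg r) → s'.mem = s.mem →
      s'.reg 10 = t.slot → s'.reg 11 = t.fst → s'.reg 12 = t.snd → Q s') :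
    loadTop.wp W Q s := by
  have h₁ := family_address_lt ht hu
  have h₃ := hW.large
  have hsp' : s.reg 5 - 3 = stackBase n k + 3 * b.length := by omega
  obtain ⟨m₁, m₂, m₃, -⟩ := hm.stack
  simp only [loadTop, Program.wp, State.setReg_reg, State.setReg_mem, hs.r7, hs.r6, if_true,
    if_false, Nat.reduceEqDiff, hsp', m₁, add_assoc, Nat.reduceAdd]
  simp only [← add_assoc, m₂, m₃]
  refine ⟨by omega, by omega, by omega, by omega, by omega, by omega, h _ (fun r h₁ h₂ h₃ h₄ => ?_)
    rfl ?_ ?_ ?_⟩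
  · simp [h₁, h₂, h₃, h₄]
  · simp
  · simp
  · simp

theorem wp_apply (hW : WordSize W n k M e) {s : State} (hs : Registers n k s)
    (hm : Memory n k e f a s.mem) (hf : ∀ i x, f i x < M)
    (hi : s.reg 10 ≤ k) (hu : s.reg 11 < n) (hv : s.reg 12 < n) (huv : s.reg 11 ≠ s.reg 12)
    {Q : State → Prop}
    (h : ∀ s', Agree s s' → Memory n k e (addMove f (s.reg 10) (s.reg 11) (s.reg 12)) a s'.mem →
      Q s') : apply.wp W Q s := by
  have h₃ := hW.large
  have hA := hm.family _ hi _ hu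
  have hB := hm.family _ hi _ hv
  have hfu := hf (s.reg 10) (s.reg 11)
  have hfv := hf (s.reg 10) (s.reg 12)
  -- The two cells differ, so the first store does not affect the second load.
  have hne : ¬ (s.reg 10 * n + (n * n + 2) + s.reg 12 =
      s.reg 10 * n + (n * n + 2) + s.reg 11) := by omega
  refine wp_address hW hs (by decide) (by decide) hi hu hv fun s' hr hmem h18 h19 => ?_
  have h6 : s'.reg 6 = 1 := by rw [hr _ (by decide) (by decide), hs.r6]
  simp only [Program.wp, State.setReg_reg, State.setReg_mem, State.setMem_reg, State.setMem_mem,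
    if_true, if_false, Nat.reduceEqDiff, h6, h18, h19, hmem, hne, hA, hB]
  refine ⟨by omega, by omega, by omega, by omega, by omega, by omega, h _ (fun r hr' => ?_) ?_⟩
  · have : r ≠ 18 ∧ r ≠ 19 ∧ r ≠ 20 := by omega
    simp [this, hr]
  · refine ((hm.setFamily hi hu (x := f (s.reg 10) (s.reg 11) + 1) fun _ => rfl).setFamily hi hv
      (x := f (s.reg 10) (s.reg 12) + 1) fun y => ?_).congr_family fun i x => ?_
    · simp [hmem]
    · simp only [addMove]
      split_ifs <;> grind

theorem wp_undo (hW : WordSize W n k M e) {s : State} (hs : Registers n k s)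
    (hf : ∀ i x, f i x < M)
    (hi : s.reg 10 ≤ k) (hu : s.reg 11 < n) (hv : s.reg 12 < n) (huv : s.reg 11 ≠ s.reg 12)
    (hm : Memory n k e (addMove f (s.reg 10) (s.reg 11) (s.reg 12)) a s.mem)
    {Q : State → Prop}
    (h : ∀ s', (∀ r, r ≠ 18 → r ≠ 19 → r ≠ 20 → s'.reg r = s.reg r) →
      Memory n k e f a s'.mem → Q s') : undo.wp W Q s := by
  have h₃ := hW.large
  have hA := hm.family _ hi _ hu
  have hB := hm.family _ hi _ hv
  have hfu := hf (s.reg 10) (s.reg 11)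
  have hfv := hf (s.reg 10) (s.reg 12)
  have hA' : addMove f (s.reg 10) (s.reg 11) (s.reg 12) (s.reg 10) (s.reg 11) =
    f (s.reg 10) (s.reg 11) + 1 := by simp [addMove]
  have hB' : addMove f (s.reg 10) (s.reg 11) (s.reg 12) (s.reg 10) (s.reg 12) =
    f (s.reg 10) (s.reg 12) + 1 := by simp [addMove]
  have hne : ¬ (s.reg 10 * n + (n * n + 2) + s.reg 12 =
      s.reg 10 * n + (n * n + 2) + s.reg 11) := by omega
  refine wp_address hW hs (by decide) (by decide) hi hu hv fun s' hr hmem h18 h19 => ?_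
  have h6 : s'.reg 6 = 1 := by rw [hr _ (by decide) (by decide), hs.r6]
  simp only [Program.wp, State.setReg_reg, State.setReg_mem, State.setMem_reg, State.setMem_mem,
    if_true, if_false, Nat.reduceEqDiff, h6, h18, h19, hmem, hne, hA, hB, hA',
    hB', Nat.add_sub_cancel]
  refine ⟨by omega, by omega, by omega, by omega, by omega, by omega, h _ (fun r h₁ h₂ h₃ => ?_) ?_⟩
  · simp [h₁, h₂, h₃, hr]
  · refine ((hm.setFamily hi hu (x := f (s.reg 10) (s.reg 11)) fun _ => rfl).setFamily hi hv
      (x := f (s.reg 10) (s.reg 12)) fun y => ?_).congr_family fun i x => ?_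
    · simp [hmem]
    · simp only [addMove]
      split_ifs <;> grind

end CliqueSearch

/-! ### Correctness of the stack operations. -/

namespace CliqueSearch

open WordRAM Program Finset

variable {W n k M : ℕ} {e f : ℕ → ℕ → ℕ} {a b : List Move} {m : ℕ → ℕ}

/-- The state represents the sequence `a` of moves. -/
structure Config (n k : ℕ) (e : ℕ → ℕ → ℕ) (a : List Move) (s : State) : Prop where
  regs : Registers n k s
  sp : s.reg 5 = stackBase n k + 3 * a.length
  mem : Memory n k e (cnt a) a s.mem

theorem Config.of_agree {s s' : State} (h : Config n k e a s) (hs : Agree s s')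
    (hm : s'.mem = s.mem) : Config n k e a s' :=
  ⟨h.regs.of_agree hs, (hs 5 (by decide)).trans h.sp, hm ▸ h.mem⟩

theorem cnt_lt {i x : ℕ} (hl : b.length + 1 ≤ M) : cnt b i x < M :=
  (cnt_le_length b i x).trans_lt hl

/-- Afterwards the counters are those of `b` while `t` is still on the stack. Such intermediate
states are why `Memory` treats family and stack as independent. -/
theorem wp_drop (hW : WordSize W n k M e) {s : State} {t : Move} (hs : Config n k e (t :: b) s)
    (hl : b.length + 1 ≤ M) (ht : t.slot ≤ k) (hv : t.snd < t.fst) (hu : t.fst < n)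
    {Q : State → Prop}
    (h : ∀ s', Agree s s' → Memory n k e (cnt b) (t :: b) s'.mem →
      s'.reg 10 = t.slot → s'.reg 11 = t.fst → s'.reg 12 = t.snd → Q s') :
    (Program.seq loadTop undo).wp W Q s := by
  refine wp_loadTop hW hs.regs hs.mem hs.sp hl ht hv hu fun s₁ hr₁ hm₁ h10 h11 h12 => ?_
  have ha₁ : Agree s s₁ := fun r hr => hr₁ r (by omega) (by omega) (by omega) (by omega)
  refine wp_undo (f := cnt b) (a := t :: b) hW (hs.regs.of_agree ha₁) (fun _ _ => cnt_lt hl) (h10.trans_le ht)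
    (h11.trans_lt hu) (by omega) (by omega) ?_ fun s₂ hr₂ hm₂ => ?_
  · rw [h10, h11, h12, hm₁]
    exact hs.mem
  · refine h s₂ (fun r hr => ?_) hm₂ ?_ ?_ ?_
    · rw [hr₂ r (by omega) (by omega) (by omega), ha₁ r hr]
    · rw [hr₂ _ (by decide) (by decide) (by decide), h10]
    · rw [hr₂ _ (by decide) (by decide) (by decide), h11]
    · rw [hr₂ _ (by decide) (by decide) (by decide), h12]

theorem wp_bump (hW : WordSize W n k M e) {s : State} {t : Move} (hs : Config n k e (t :: b) s)
    (hl : b.length + 1 ≤ M) (ht : t.slot < k) (hv : t.snd < t.fst) (hu : t.fst < n)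
    {Q : State → Prop}
    (h : ∀ s', Agree s s' → Config n k e (t.withSlot (t.slot + 1) :: b) s' → Q s') :
    bump.wp W Q s := by
  refine wp_drop (Q := (Program.seq storeSlot apply).wp W Q) hW hs hl ht.le hv hu
    fun s₁ ha₁ hm₁ h10 h11 h12 => ?_
  have hr₁ := hs.regs.of_agree ha₁
  have hsp₁ : s₁.reg 5 = stackBase n k + 3 * (b.length + 1) := (ha₁ 5 (by decide)).trans hs.sp
  have hsp' : s₁.reg 5 - 3 = stackBase n k + 3 * b.length := by omega
  have hL := hW.large
  obtain ⟨q₁, q₂, q₃, q₄⟩ := hm₁.stack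
  simp only [storeSlot, Program.wp, State.setReg_reg,
    if_true, if_false, Nat.reduceEqDiff, hr₁.r6, hr₁.r7, h10, hsp']
  refine ⟨by omega, by omega, by omega, ?_⟩
  generalize hs₂ : State.setMem _ _ _ = s₂
  have hr₂ : ∀ r, r ≠ 10 → r ≠ 26 → s₂.reg r = s₁.reg r := fun r h₁ h₂ => by
    subst hs₂
    simp [h₁, h₂]
  have h10' : s₂.reg 10 = t.slot + 1 := by subst hs₂; simp
  have hmem : ∀ y, s₂.mem y = if y = stackBase n k + 3 * b.length then t.slot + 1 else s₁.mem y :=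
    fun y => by subst hs₂; simp
  have h11' : s₂.reg 11 = t.fst := by rw [hr₂ _ (by decide) (by decide), h11]
  have h12' : s₂.reg 12 = t.snd := by rw [hr₂ _ (by decide) (by decide), h12]
  have ha₂ : Agree s s₂ := fun r hr => by rw [hr₂ r (by omega) (by omega), ha₁ r hr]
  have hm₂ : Memory n k e (cnt b) (t.withSlot (t.slot + 1) :: b) s₂.mem := by
    refine hm₁.of_stack (fun y hy => ?_) ⟨?_, ?_, ?_, q₄.congr fun x _ hx => ?_⟩
    · rw [hmem, if_neg (by omega)]
    · rw [hmem, if_pos rfl]; rfl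
    · rw [hmem, if_neg (by omega), q₂]; rfl
    · rw [hmem, if_neg (by omega), q₃]; rfl
    · rw [hmem, if_neg (by omega)]
  -- The new slot may equal `k`; the move then goes to the spare row.
  refine wp_apply hW (hs.regs.of_agree ha₂) hm₂ (fun _ _ => cnt_lt hl) (by omega) (by omega)
    (by omega) (by omega) fun s₃ ha₃ hm₃ => ?_
  have ha₃' : Agree s s₃ := fun r hr => (ha₃ r hr).trans (ha₂ r hr)
  refine h s₃ ha₃' ⟨hs.regs.of_agree ha₃', (ha₃' 5 (by decide)).trans hs.sp, ?_⟩
  rw [h10', h11', h12'] at hm₃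
  exact hm₃

theorem wp_pop (hW : WordSize W n k M e) {s : State} {t : Move} (hs : Config n k e (t :: b) s)
    (hl : b.length + 1 ≤ M) (ht : t.slot ≤ k) (hv : t.snd < t.fst) (hu : t.fst < n)
    (hb : ∀ t' b', b = t' :: b' → t'.slot < k ∧ t'.snd < t'.fst ∧ t'.fst < n)
    {Q : State → Prop}
    (hnil : ∀ s', b = [] → s'.reg 8 = 0 → s'.reg 0 = 0 → Q s')
    (hcons : ∀ s' t' b', b = t' :: b' → s'.reg 8 = s.reg 8 →
      Config n k e (t'.withSlot (t'.slot + 1) :: b') s' → Q s') :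
    pop.wp W Q s := by
  refine wp_drop (Q := (Program.seq (.seq (.sub 5 5 7) (.sub 26 5 4)) _).wp W Q) hW hs hl ht hv hu
    fun s₁ ha₁ hm₁ h10 h11 h12 => ?_
  have hr₁ := hs.regs.of_agree ha₁
  have hsp₁ : s₁.reg 5 = stackBase n k + 3 * (b.length + 1) := (ha₁ 5 (by decide)).trans hs.sp
  have hsp' : s₁.reg 5 - 3 = stackBase n k + 3 * b.length := by omega
  have hL := hW.large
  obtain ⟨q₁, q₂, q₃, q₄⟩ := hm₁.stack
  rw [Program.wp, Program.wp, Program.wp, Program.wp]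
  simp only [State.setReg_reg, if_true, if_false, Nat.reduceEqDiff, hr₁.r7, hsp', hr₁.r4,
    Nat.add_sub_cancel_left]
  refine ⟨by omega, by omega, ?_⟩
  generalize hs₂ : State.setReg _ _ _ = s₂
  have hr₂ : ∀ r, r ≠ 5 → r ≠ 26 → s₂.reg r = s₁.reg r := fun r h₁ h₂ => by
    subst hs₂
    simp [h₁, h₂]
  have h5 : s₂.reg 5 = stackBase n k + 3 * b.length := by subst hs₂; simp
  have h26 : s₂.reg 26 = 3 * b.length := by subst hs₂; simp
  have hmem : s₂.mem = s₁.mem := by subst hs₂; rfl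
  have hc : Config n k e b s₂ := by
    refine ⟨?_, h5, hmem ▸ ⟨hm₁.matrix, hm₁.family, q₄⟩⟩
    constructor <;> rw [hr₂ _ (by decide) (by decide)]
    exacts [hr₁.r1, hr₁.r2, hr₁.r3, hr₁.r4, hr₁.r6, hr₁.r7, hr₁.r27, hr₁.r28]
  -- Register 26 is three times the height of the remaining stack, hence zero exactly when no move
  -- is left.
  refine ⟨fun h => ?_, fun h => ?_⟩
  · cases hb' : b with
    | nil => simp [h26, hb'] at h
    | cons t' b' =>
      subst hb'
      obtain ⟨ht', hv', hu'⟩ := hb _ _ rfl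
      refine wp_bump hW hc (by simp only [List.length_cons] at hl; omega) ht' hv' hu'
        fun s₃ ha₃ hc₃ => hcons s₃ _ _ rfl ?_ hc₃
      rw [ha₃ 8 (by decide), hr₂ _ (by decide) (by decide), ha₁ 8 (by decide)]
  · have hb' : b = [] := List.length_eq_zero_iff.1 (by omega)
    simp only [Program.wp]
    exact ⟨by omega, by omega, hnil _ hb' (by simp) (by simp)⟩

theorem wp_push (hW : WordSize W n k M e) {s : State} (hs : Config n k e a s)
    (hl : a.length + 1 ≤ M) (hv : s.reg 17 < s.reg 16) (hu : s.reg 16 < n)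
    {Q : State → Prop}
    (h : ∀ s', s'.reg 8 = s.reg 8 → Config n k e (⟨0, s.reg 16, s.reg 17⟩ :: a) s' → Q s') :
    push.wp W Q s := by
  have hL := hW.large
  have hst := family_address_lt (Nat.zero_le k) hu
  have hr := hs.regs
  change pushStack.wp W (apply.wp W Q) s
  simp only [pushStack, Program.wp, State.setReg_reg, State.setMem_reg,
    if_true, if_false, Nat.reduceEqDiff, hr.r6, hr.r7, hr.r28, hs.sp, add_zero, add_assoc,
    Nat.reduceAdd]
  refine ⟨by omega, by omega, by omega, by omega, by omega, by omega, by omega, by omega,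
    by omega, ?_⟩
  generalize hs₂ : State.setReg _ 5 _ = s₂
  have hr₂ : ∀ r, r ≠ 10 → r ≠ 11 → r ≠ 12 → r ≠ 26 → r ≠ 5 → s₂.reg r = s.reg r :=
    fun r h₁ h₂ h₃ h₄ h₅ => by
      subst hs₂
      simp [h₁, h₂, h₃, h₄, h₅]
  have h5 : s₂.reg 5 = stackBase n k + 3 * (a.length + 1) := by subst hs₂; simp; ring
  have h10 : s₂.reg 10 = 0 := by subst hs₂; simp
  have h11 : s₂.reg 11 = s.reg 16 := by subst hs₂; simp
  have h12 : s₂.reg 12 = s.reg 17 := by subst hs₂; simp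
  have hmem : ∀ y, s₂.mem y = if y = stackBase n k + (3 * a.length + 2) then s.reg 17 else
      if y = stackBase n k + (3 * a.length + 1) then s.reg 16 else
      if y = stackBase n k + 3 * a.length then 0 else s.mem y :=
    fun y => by subst hs₂; simp
  have hregs : Registers n k s₂ := by
    constructor <;> rw [hr₂ _ (by decide) (by decide) (by decide) (by decide) (by decide)]
    exacts [hr.r1, hr.r2, hr.r3, hr.r4, hr.r6, hr.r7, hr.r27, hr.r28]
  have hm₂ : Memory n k e (cnt a) (⟨0, s.reg 16, s.reg 17⟩ :: a) s₂.mem := by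
    refine hs.mem.of_stack (fun y hy => ?_) ⟨?_, ?_, ?_, hs.mem.stack.congr fun x _ hx => ?_⟩
    · rw [hmem, if_neg (by omega), if_neg (by omega), if_neg (by omega)]
    · rw [hmem, if_neg (by omega), if_neg (by omega), if_pos rfl]
    · rw [hmem, if_neg (by omega), if_pos (by omega)]
    · rw [hmem, if_pos (by omega)]
    · rw [hmem, if_neg (by omega), if_neg (by omega), if_neg (by omega)]
  refine wp_apply hW hregs hm₂ (fun _ _ => cnt_lt hl) (by omega) (by omega) (by omega) (by omega)
    fun s₃ ha₃ hm₃ => h s₃ ?_ ⟨hregs.of_agree ha₃, (ha₃ 5 (by decide)).trans h5, ?_⟩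
  · rw [ha₃ 8 (by decide), hr₂ _ (by decide) (by decide) (by decide) (by decide) (by decide)]
  · rw [h10, h11, h12] at hm₃
    exact hm₃

theorem wp_test (hW : WordSize W n k M e) {s : State} (hs : Config n k e a s)
    (hl : a.length ≤ M) (ht : ∀ t ∈ a.head?, t.slot ≤ k ∧ t.snd < t.fst ∧ t.fst < n)
    {Q : State → Prop}
    (h : ∀ s', Agree s s' → s'.mem = s.mem → s'.reg 15 = 0 → (s'.reg 14 ≠ 0 ↔ Idle a) →
      (s'.reg 13 ≠ 0 ↔ ∃ t ∈ a.head?, t.slot = k) → Q s') :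
    test.wp W Q s := by
  have hL := hW.large
  have hr := hs.regs
  rw [test, Program.wp, Program.wp, Program.wp, Program.wp, Program.wp, Program.wp, Program.wp,
    Program.wp, Program.wp]
  simp only [State.setReg_reg, if_true, if_false, Nat.reduceEqDiff, hs.sp, hr.r4,
    Nat.add_sub_cancel_left]
  refine ⟨by omega, by omega, by omega, by omega, ?_⟩
  generalize hs₂ : State.setReg _ 26 _ = s₂
  have ha₂ : Agree s s₂ := fun r hr => by
    have : r ≠ 13 ∧ r ≠ 14 ∧ r ≠ 15 ∧ r ≠ 26 := by omega
    subst hs₂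
    simp [this]
  have hc := hs.of_agree ha₂ (by subst hs₂; rfl)
  have hm₂ : s₂.mem = s.mem := by subst hs₂; rfl
  have h13 : s₂.reg 13 = 0 := by subst hs₂; simp
  have h14 : s₂.reg 14 = 0 := by subst hs₂; simp
  have h15 : s₂.reg 15 = 0 := by subst hs₂; simp
  clear hs₂
  cases a with
  | nil =>
    refine ⟨fun h0 => (h0 (by simp)).elim, fun _ => h s₂ ha₂ hm₂ h15 ?_ ?_⟩
    · simp [h14, Idle]
    · simp [h13]
  | cons t b =>
    refine ⟨fun _ => ?_, fun h0 => by simp at h0⟩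
    obtain ⟨ht, hv, hu⟩ := ht t rfl
    refine wp_loadTop hW hc.regs hc.mem hc.sp hl ht hv hu fun s₃ hr₃ hm₃ g10 g11 g12 => ?_
    have ha₃ : Agree s₂ s₃ := fun r hr => hr₃ r (by omega) (by omega) (by omega) (by omega)
    have hc₃ := hc.of_agree ha₃ hm₃
    refine wp_address hW hc₃.regs (by decide) (by decide) (by omega) (by omega) (by omega)
      fun s₄ hr₄ hm₄ g18 g19 => ?_
    have ha₄ : Agree s₃ s₄ := fun r hr => hr₄ r (by omega) (by omega)
    have hc₄ := hc₃.of_agree ha₄ hm₄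
    have k10 : s₄.reg 10 = t.slot := by rw [hr₄ _ (by decide) (by decide), g10]
    have k13 : s₄.reg 13 = 0 := by
      rw [hr₄ _ (by decide) (by decide), hr₃ _ (by decide) (by decide) (by decide) (by decide), h13]
    have k14 : s₄.reg 14 = 0 := by
      rw [hr₄ _ (by decide) (by decide), hr₃ _ (by decide) (by decide) (by decide) (by decide), h14]
    have k15 : s₄.reg 15 = 0 := by
      rw [hr₄ _ (by decide) (by decide), hr₃ _ (by decide) (by decide) (by decide) (by decide), h15]
    rw [g10, g11] at g18
    rw [g10, g12] at g19
    have hA := hc₄.mem.family _ ht _ hu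
    have hB := hc₄.mem.family _ ht _ (hv.trans hu)
    have hA' : cnt (t :: b) t.slot t.fst = cnt b t.slot t.fst + 1 := by simp [cnt]
    have hB' : cnt (t :: b) t.slot t.snd = cnt b t.slot t.snd + 1 := by simp [cnt]
    have hfu : cnt b t.slot t.fst < M := cnt_lt hl
    have hfv : cnt b t.slot t.snd < M := cnt_lt hl
    rw [hA'] at hA
    rw [hB'] at hB
    -- The slot test is the common continuation of all three outcomes of the idle test. The latter
    -- looks at the counters minus one, that is, before the last move.
    have hlast : ∀ s₅ : State, (∀ r, r ≠ 20 → r ≠ 21 → r ≠ 14 → s₅.reg r = s₄.reg r) →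
        s₅.mem = s₄.mem → (s₅.reg 14 ≠ 0 ↔ Idle (t :: b)) →
        testSlot.wp W Q s₅ := by
      intro s₅ hr₅ hm₅ h14
      have hag : ∀ s₆ : State, (∀ r, r ≠ 26 → r ≠ 13 → s₆.reg r = s₅.reg r) → Agree s s₆ :=
        fun s₆ hr₆ r hr => by
          rw [hr₆ r (by omega) (by omega), hr₅ r (by omega) (by omega) (by omega), ha₄ r hr,
            ha₃ r hr, ha₂ r hr]
      have j1 : s₅.reg 1 = k := by
        rw [hr₅ _ (by decide) (by decide) (by decide), hc₄.regs.r1]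
      have j10 : s₅.reg 10 = t.slot := by
        rw [hr₅ _ (by decide) (by decide) (by decide), k10]
      have j13 : s₅.reg 13 = 0 := by
        rw [hr₅ _ (by decide) (by decide) (by decide), k13]
      have j15 : s₅.reg 15 = 0 := by
        rw [hr₅ _ (by decide) (by decide) (by decide), k15]
      simp only [testSlot, Program.wp, State.setReg_reg, if_true, j1, j10]
      refine ⟨by omega, fun hne => ?_, fun he => ⟨by omega, ?_⟩⟩
      · refine h _ (hag _ fun r h₁ _ => by simp [h₁]) ?_ (by simp [j15]) (by simpa using h14) ?_
        · simp [hm₅, hm₄, hm₃, hm₂]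
        · have : t.slot ≠ k := by omega
          simp [j13, this]
      · refine h _ (hag _ fun r h₁ h₂ => by simp [h₁, h₂]) ?_ (by simp [j15]) (by simpa using h14) ?_
        · simp [hm₅, hm₄, hm₃, hm₂]
        · have : t.slot = k := by omega
          simp [this]
    simp only [Program.wp, State.setReg_reg, State.setReg_mem, if_true, if_false, Nat.reduceEqDiff,
      g18, g19, hA, hB, hc₄.regs.r6, Nat.add_sub_cancel]
    refine ⟨by omega, by omega, by omega, by omega, fun hx => ⟨fun hy => ⟨by omega, ?_⟩, fun hy => ?_⟩,
      fun hx => ?_⟩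
    · refine hlast _ (fun r h₁ h₂ h₃ => by simp [h₁, h₂, h₃]) rfl ?_
      simp [Idle, hx, hy]
    · refine hlast _ (fun r h₁ h₂ h₃ => by simp [h₁, h₂]) rfl ?_
      simp [Idle, hy, k14]
    · refine hlast _ (fun r h₁ h₂ h₃ => by simp [h₁, h₂]) rfl ?_
      simp [Idle, hx, k14]

end CliqueSearch

/-! ### Correctness of the scan over all pairs. -/

namespace CliqueSearch

open WordRAM Program Finset

variable {W n k M : ℕ} {e f : ℕ → ℕ → ℕ} {a b : List Move} {m : ℕ → ℕ}

/-- The flags after the pairs in `P` have been checked. -/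
structure Scanned (n k : ℕ) (e f : ℕ → ℕ → ℕ) (R : Prop) (P : ℕ → ℕ → Prop) (s : State) :
    Prop where
  bad : s.reg 14 ≠ 0 ↔ R ∨ ∃ u v, P u v ∧ e u v < cov k f u v
  found : s.reg 15 ≠ 0 → s.reg 16 < n ∧ s.reg 17 < s.reg 16 ∧
    cov k f (s.reg 16) (s.reg 17) < e (s.reg 16) (s.reg 17)
  covered : s.reg 15 = 0 → ∀ u v, P u v → e u v ≤ cov k f u v

theorem Scanned.congr {R : Prop} {P P' : ℕ → ℕ → Prop} {s s' : State}
    (h : Scanned n k e f R P s) (hP : ∀ u v, P u v ↔ P' u v) (h14 : s'.reg 14 = s.reg 14)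
    (h15 : s'.reg 15 = s.reg 15) (h16 : s'.reg 16 = s.reg 16) (h17 : s'.reg 17 = s.reg 17) :
    Scanned n k e f R P' s' := by
  obtain rfl : P = P' := funext₂ fun u v => propext (hP u v)
  constructor
  · rw [h14]; exact h.bad
  · rw [h15, h16, h17]; exact h.found
  · rw [h15]; exact h.covered

/-- What the scan needs of a state and does not change. -/
structure ScanEnv (n k : ℕ) (e f : ℕ → ℕ → ℕ) (a : List Move) (s₀ s : State) : Prop where
  agree : Agree s₀ s
  same : s.mem = s₀.mem
  regs : Registers n k s
  mem : Memory n k e f a s.mem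

theorem ScanEnv.trans {s₀ s s' : State} (h : ScanEnv n k e f a s₀ s) (ha : Agree s s')
    (hm : s'.mem = s.mem) : ScanEnv n k e f a s₀ s' :=
  ⟨fun r hr => (ha r hr).trans (h.agree r hr), hm.trans h.same, h.regs.of_agree ha, hm ▸ h.mem⟩

theorem cov_le (f : ℕ → ℕ → ℕ) (u v : ℕ) : cov k f u v ≤ k :=
  (card_filter_le _ _).trans (card_range k).le

/-- Sets are visited from the last to the first; the invariant is that the count so far plus the
coverage by the first `j` sets equals the full coverage. -/
theorem halts_count (hW : WordSize W n k M e) (hf : ∀ i x, f i x ≤ M) {s : State} {s₀ : State}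
    (hs : ScanEnv n k e f a s₀ s) (hu : s.reg 22 < n) (hv : s.reg 23 < n) (h24 : s.reg 24 = k)
    (h25 : s.reg 25 = 0) :
    Halts W (.loop 24 countStep) (k * 15 + 1) (fun s' => s'.mem = s.mem ∧
      (∀ r, r < 18 ∨ r = 22 ∨ r = 23 ∨ 26 < r → s'.reg r = s.reg r) ∧
      s'.reg 25 = cov k f (s.reg 22) (s.reg 23)) s := by
  have hL := hW.large
  refine (Halts.countdown (T := 14) (I := fun j s' => s'.reg 24 = j ∧ j ≤ k ∧ s'.mem = s.mem ∧
      (∀ r, r < 18 ∨ r = 22 ∨ r = 23 ∨ 26 < r → s'.reg r = s.reg r) ∧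
      s'.reg 25 + cov j f (s.reg 22) (s.reg 23) = cov k f (s.reg 22) (s.reg 23))
    (fun _ _ h => h.1) (fun j s₁ h => ?_) k s ⟨h24, le_rfl, rfl, fun _ _ => rfl, by omega⟩).mono
    le_rfl fun s' h => ⟨h.2.2.1, h.2.2.2.1, by simpa [cov] using h.2.2.2.2⟩
  obtain ⟨g24, hj, hm, hr, hc⟩ := h
  refine Halts.mono (T := countStep.cost) (Program.wp.halts ?_) (by decide) fun _ => id
  have he : ScanEnv n k e f a s₀ s₁ := hs.trans (fun r h => hr r (by omega)) hm
  rw [countStep, Program.wp, Program.wp]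
  simp only [g24, he.regs.r6, Nat.add_sub_cancel]
  refine ⟨by omega, ?_⟩
  generalize hs₂ : State.setReg _ _ _ = s₂
  have hr₂ : ∀ r, r ≠ 24 → s₂.reg r = s₁.reg r := fun r h => by subst hs₂; simp [h]
  have h24₂ : s₂.reg 24 = j := by subst hs₂; simp
  have hm₂ : s₂.mem = s₁.mem := by subst hs₂; rfl
  have he₂ := he.trans (s' := s₂) (fun r h => hr₂ r (by omega)) hm₂
  have h22₂ : s₂.reg 22 = s.reg 22 := by rw [hr₂ _ (by decide), hr _ (by decide)]
  have h23₂ : s₂.reg 23 = s.reg 23 := by rw [hr₂ _ (by decide), hr _ (by decide)]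
  refine wp_address hW he₂.regs (by decide) (by decide) (by omega) (by omega) (by omega)
    fun s₃ hr₃ hm₃ h18 h19 => ?_
  have hmem : s₃.mem = s.mem := hm₃.trans (hm₂.trans hm)
  have hA := hs.mem.family j (by omega) _ hu
  have hB := hs.mem.family j (by omega) _ hv
  have hfu := hf j (s.reg 22)
  have hfv := hf j (s.reg 23)
  have h6 : s₃.reg 6 = 1 := by rw [hr₃ _ (by decide) (by decide), he₂.regs.r6]
  have h25₃ : s₃.reg 25 = s₁.reg 25 := by rw [hr₃ _ (by decide) (by decide), hr₂ _ (by decide)]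
  have h24₃ : s₃.reg 24 = j := by rw [hr₃ _ (by decide) (by decide), h24₂]
  have hreg : ∀ r, r < 18 ∨ r = 22 ∨ r = 23 ∨ 26 < r → s₃.reg r = s.reg r := fun r h => by
    rw [hr₃ _ (by omega) (by omega), hr₂ _ (by omega), hr _ h]
  rw [h24₂, h22₂] at h18
  rw [h24₂, h23₂] at h19
  have hck := cov_le (k := k) f (s.reg 22) (s.reg 23)
  rw [cov_succ] at hc
  simp only [Program.wp, State.setReg_reg, State.setReg_mem, if_true, if_false, Nat.reduceEqDiff,
    h18, h19, hmem, hA, hB, h6, h25₃]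
  refine ⟨by omega, by omega, fun hx => ⟨fun hy => ⟨by omega, ?_⟩, fun hy => ?_⟩, fun hx => ?_⟩
  · refine ⟨by simp [h24₃], by omega, trivial, fun r h => ?_, ?_⟩
    · have : r ≠ 20 ∧ r ≠ 21 ∧ r ≠ 25 := by omega
      simp [this, hreg r h]
    · rw [if_pos ⟨hx, hy⟩] at hc
      omega
  · refine ⟨by simp [h24₃], by omega, trivial, fun r h => ?_, ?_⟩
    · have : r ≠ 20 ∧ r ≠ 21 ∧ r ≠ 25 := by omega
      simp [this, hreg r h]
    · rw [if_neg (by tauto)] at hc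
      omega
  · refine ⟨by simp [h24₃], by omega, trivial, fun r h => ?_, ?_⟩
    · have : r ≠ 20 ∧ r ≠ 21 ∧ r ≠ 25 := by omega
      simp [this, hreg r h]
    · rw [if_neg (by tauto)] at hc
      omega

theorem wp_compare (hW : WordSize W n k M e) {R : Prop} {P : ℕ → ℕ → Prop} {s s₀ : State}
    (hs : ScanEnv n k e f a s₀ s) {u v : ℕ} (hu : u < n) (hv : v < u)
    (h22 : s.reg 22 = u) (h23 : s.reg 23 = v) (h25 : s.reg 25 = cov k f u v)
    (hsc : Scanned n k e f R P s) {Q : State → Prop}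
    (h : ∀ s', Agree s s' → s'.mem = s.mem → s'.reg 22 = u → s'.reg 23 = v →
      Scanned n k e f R (fun x y => P x y ∨ (x = u ∧ y = v)) s' → Q s') :
    compare.wp W Q s := by
  have hL := hW.large
  have hA := hs.mem.matrix u hu v (by omega)
  have hadd := matrix_address_lt hu (hv.trans hu)
  have hlt : n * n + 2 + n ≤ stackBase n k := by unfold stackBase; omega
  have hE := hW.entry u v
  have hck := cov_le (k := k) f u v
  have hr := hs.regs
  obtain ⟨hb, hfd, hcv⟩ := hsc
  simp only [compare, Program.wp, State.setReg_reg, State.setReg_mem, if_true, if_false,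
    Nat.reduceEqDiff, hr.r3, hr.r27, hr.r28, h22, h23, h25, hA, add_zero]
  -- A pair cannot be covered both too often and too rarely, which leaves three of four branches.
  refine ⟨by omega, by omega, by omega, by omega, by omega,
    fun hx => ⟨by omega, by omega, fun hy => absurd hy (by omega), fun hy => ?_⟩,
    fun hx => ⟨by omega, fun hy => ⟨by omega, by omega, by omega, ?_⟩, fun hy => ?_⟩⟩
  · refine h _ (fun r hr => ?_) rfl (by simp [h22]) (by simp [h23]) ⟨?_, ?_, ?_⟩
    · have : r ≠ 20 ∧ r ≠ 26 ∧ r ≠ 14 := by omega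
      simp [this]
    · simp only [State.setReg_reg]
      refine ⟨fun _ => .inr ⟨u, v, .inr ⟨rfl, rfl⟩, by omega⟩, fun _ => by simp⟩
    · simpa using hfd
    · intro h15 x y hxy
      rcases hxy with hxy | ⟨rfl, rfl⟩
      · exact hcv (by simpa using h15) x y hxy
      · omega
  · refine h _ (fun r hr => ?_) rfl (by simp [h22]) (by simp [h23]) ⟨?_, ?_, ?_⟩
    · have : r ≠ 20 ∧ r ≠ 26 ∧ r ≠ 15 ∧ r ≠ 16 ∧ r ≠ 17 := by omega
      simp [this]
    · simp only [State.setReg_reg, Nat.reduceEqDiff, if_false]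
      rw [hb]
      refine or_congr_right ⟨fun ⟨x, y, hxy, hlt⟩ => ⟨x, y, .inl hxy, hlt⟩, ?_⟩
      rintro ⟨x, y, hxy | ⟨rfl, rfl⟩, hlt⟩
      · exact ⟨x, y, hxy, hlt⟩
      · omega
    · intro _
      simp only [State.setReg_reg, Nat.reduceEqDiff, if_false, if_true]
      exact ⟨hu, hv, by omega⟩
    · intro h15
      simp at h15
  · refine h _ (fun r hr => ?_) rfl (by simp [h22]) (by simp [h23]) ⟨?_, ?_, ?_⟩
    · have : r ≠ 20 ∧ r ≠ 26 := by omega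
      simp [this]
    · simp only [State.setReg_reg, Nat.reduceEqDiff, if_false]
      rw [hb]
      refine or_congr_right ⟨fun ⟨x, y, hxy, hlt⟩ => ⟨x, y, .inl hxy, hlt⟩, ?_⟩
      rintro ⟨x, y, hxy | ⟨rfl, rfl⟩, hlt⟩
      · exact ⟨x, y, hxy, hlt⟩
      · omega
    · simpa using hfd
    · intro h15 x y hxy
      rcases hxy with hxy | ⟨rfl, rfl⟩
      · exact hcv (by simpa using h15) x y hxy
      · omega

theorem halts_pairStep (hW : WordSize W n k M e) (hf : ∀ i x, f i x ≤ M) {R : Prop}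
    {P : ℕ → ℕ → Prop} {s s₀ : State} (hs : ScanEnv n k e f a s₀ s) {u v : ℕ} (hu : u < n)
    (hv : v < u) (h22 : s.reg 22 = u) (h23 : s.reg 23 = v + 1) (hsc : Scanned n k e f R P s) :
    Halts W pairStep (k * 15 + 20) (fun s' => ScanEnv n k e f a s₀ s' ∧ s'.reg 22 = u ∧
      s'.reg 23 = v ∧ Scanned n k e f R (fun x y => P x y ∨ (x = u ∧ y = v)) s') s := by
  have hL := hW.large
  have hstart : (Program.seq (.sub 23 23 6) <| .seq (.const 25 0) (.add 24 1 28)).wp W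
      (fun s' => (∀ r, r < 23 ∨ 26 < r → s'.reg r = s.reg r) ∧ s'.mem = s.mem ∧ s'.reg 23 = v ∧
        s'.reg 24 = k ∧ s'.reg 25 = 0) s := by
    have hn : n ≤ stackBase n k := by unfold stackBase; omega
    simp only [Program.wp, State.setReg_reg, if_true, if_false, Nat.reduceEqDiff, hs.regs.r6,
      hs.regs.r1, hs.regs.r28, h23, add_zero]
    refine ⟨by omega, by omega, by omega, fun r hr => ?_, rfl, by simp, trivial, trivial⟩
    have : r ≠ 23 ∧ r ≠ 25 ∧ r ≠ 24 := by omega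
    simp [this]
  refine Halts.mono (Halts.seq hstart.halts fun s₁ ⟨hr₁, hm₁, h23₁, h24₁, h25₁⟩ => ?_)
    (T := 3 + (k * 15 + 1 + 14)) (by omega) fun _ => id
  have he₁ := hs.trans (s' := s₁) (fun r h => hr₁ r (by omega)) hm₁
  have h22₁ : s₁.reg 22 = u := by rw [hr₁ _ (by decide), h22]
  refine Halts.seq (halts_count hW hf he₁ (by omega) (by omega) h24₁ h25₁)
    fun s₂ ⟨hm₂, hr₂, h25₂⟩ => ?_
  have he₂ := he₁.trans (s' := s₂) (fun r h => hr₂ r (by omega)) hm₂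
  refine Halts.mono (T := compare.cost) (Program.wp.halts ?_) (by decide) fun _ => id
  refine wp_compare hW he₂ hu hv ?_ ?_ ?_ (hsc.congr (s' := s₂) (fun _ _ => Iff.rfl) ?_ ?_ ?_ ?_)
    fun s₃ ha₃ hm₃ h22₃ h23₃ hsc₃ => ⟨he₂.trans ha₃ hm₃, h22₃, h23₃, hsc₃⟩
  · rw [hr₂ _ (by decide), h22₁]
  · rw [hr₂ _ (by decide), h23₁]
  · rw [h25₂, h22₁, h23₁]
  all_goals rw [hr₂ _ (by decide), hr₁ _ (by decide)]

theorem halts_rowStep (hW : WordSize W n k M e) (hf : ∀ i x, f i x ≤ M) {R : Prop}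
    {P : ℕ → ℕ → Prop} {s s₀ : State} (hs : ScanEnv n k e f a s₀ s) {u : ℕ} (hu : u < n)
    (h22 : s.reg 22 = u + 1) (hsc : Scanned n k e f R P s) :
    Halts W rowStep (n * (k * 15 + 21) + 3) (fun s' => ScanEnv n k e f a s₀ s' ∧ s'.reg 22 = u ∧
      Scanned n k e f R (fun x y => P x y ∨ (x = u ∧ y < u)) s') s := by
  have hL := hW.large
  have hn : n ≤ stackBase n k := by unfold stackBase; omega
  have hstart : (Program.seq (.sub 22 22 6) (.add 23 22 28)).wp W
      (fun s' => (∀ r, r < 22 ∨ 26 < r → s'.reg r = s.reg r) ∧ s'.mem = s.mem ∧ s'.reg 22 = u ∧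
        s'.reg 23 = u) s := by
    simp only [Program.wp, State.setReg_reg, if_true, if_false, Nat.reduceEqDiff, hs.regs.r6,
      hs.regs.r28, h22, add_zero]
    refine ⟨by omega, by omega, fun r hr => ?_, rfl, by simp, by simp⟩
    have : r ≠ 22 ∧ r ≠ 23 := by omega
    simp [this]
  have htime : 2 + (u * (k * 15 + 20 + 1) + 1) ≤ n * (k * 15 + 21) + 3 := by
    have := Nat.mul_le_mul_right (k * 15 + 21) hu.le
    change 2 + (u * (k * 15 + 21) + 1) ≤ _
    omega
  refine Halts.mono (Halts.seq hstart.halts fun s₁ ⟨hr₁, hm₁, h22₁, h23₁⟩ => ?_) htime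
    fun _ => id
  refine (Halts.countdown (r := 23) (T := k * 15 + 20) (I := fun j s' => ScanEnv n k e f a s₀ s' ∧
      s'.reg 22 = u ∧ s'.reg 23 = j ∧ j ≤ u ∧
      Scanned n k e f R (fun x y => P x y ∨ (x = u ∧ j ≤ y ∧ y < u)) s')
    (fun _ _ h => h.2.2.1) (fun j s₂ h => ?_) u s₁ ?_).mono
    le_rfl fun s' h => ⟨h.1, h.2.1, ?_⟩
  · obtain ⟨he, g22, g23, hj, hsc₂⟩ := h
    refine (halts_pairStep hW hf he hu (Nat.lt_of_succ_le hj) g22 g23 hsc₂).mono le_rfl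
      fun s₃ ⟨he₃, k22, k23, hsc₃⟩ => ⟨he₃, k22, k23, by omega, ?_⟩
    refine hsc₃.congr (fun x y => ?_) rfl rfl rfl rfl
    have : (x = u ∧ j ≤ y ∧ y < u) ↔ (x = u ∧ j + 1 ≤ y ∧ y < u) ∨ (x = u ∧ y = j) := by omega
    rw [this, or_assoc]
  · refine ⟨hs.trans (fun r h => hr₁ r (by omega)) hm₁, h22₁, h23₁, le_rfl,
      hsc.congr (fun x y => ?_) ?_ ?_ ?_ ?_⟩
    · have : ¬ (x = u ∧ u ≤ y ∧ y < u) := by omega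
      simp [this]
    all_goals rw [hr₁ _ (by decide)]
  · exact h.2.2.2.2.congr (fun x y => by simp) rfl rfl rfl rfl

/-- `R` stands for the verdict that register 14 already holds; the scan can only add to it. It never
stops early, so the registers 16 and 17 keep the last undercovered pair met. -/
theorem halts_scan (hW : WordSize W n k M e) (hf : ∀ i x, f i x ≤ M) {R : Prop} {s : State}
    (hs : Registers n k s) (hm : Memory n k e f a s.mem)
    (h14 : s.reg 14 ≠ 0 ↔ R) (h15 : s.reg 15 = 0) :
    Halts W scan (n * (n * (k * 15 + 21) + 4) + 2) (fun s' => Agree s s' ∧ s'.mem = s.mem ∧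
      Scanned n k e f R (fun x y => x < n ∧ y < x) s') s := by
  have hL := hW.large
  have hn : n ≤ stackBase n k := by unfold stackBase; omega
  have hstart : (Program.add 22 3 28).wp W
      (fun s' => (∀ r, r ≠ 22 → s'.reg r = s.reg r) ∧ s'.mem = s.mem ∧ s'.reg 22 = n) s := by
    simp only [Program.wp, hs.r3, hs.r28, add_zero]
    exact ⟨by omega, fun r hr => by simp [hr], rfl, by simp⟩
  refine Halts.mono (Halts.seq hstart.halts fun s₁ ⟨hr₁, hm₁, h22₁⟩ => ?_)
    (T := 1 + (n * (n * (k * 15 + 21) + 4) + 1)) (by omega) fun _ => id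
  refine (Halts.countdown (r := 22) (T := n * (k * 15 + 21) + 3)
    (I := fun j s' => ScanEnv n k e f a s s' ∧ s'.reg 22 = j ∧ j ≤ n ∧
      Scanned n k e f R (fun x y => j ≤ x ∧ x < n ∧ y < x) s')
    (fun _ _ h => h.2.1) (fun j s₂ h => ?_) n s₁ ?_).mono
    le_rfl fun s' h => ⟨h.1.agree, h.1.same, ?_⟩
  · obtain ⟨he, g22, hj, hsc₂⟩ := h
    refine (halts_rowStep hW hf he (Nat.lt_of_succ_le hj) g22 hsc₂).mono le_rfl
      fun s₃ ⟨he₃, k22, hsc₃⟩ => ⟨he₃, k22, by omega, ?_⟩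
    refine hsc₃.congr (fun x y => ?_) rfl rfl rfl rfl
    omega
  · refine ⟨?_, h22₁, le_rfl, ?_, ?_, ?_⟩
    · exact ScanEnv.trans (s := s) ⟨fun _ _ => rfl, rfl, hs, hm⟩ (fun r h => hr₁ r (by omega)) hm₁
    · rw [hr₁ _ (by decide), h14]
      exact ⟨.inl, fun h => h.resolve_right fun ⟨u, v, h, _⟩ => by omega⟩
    · rw [hr₁ _ (by decide)]
      exact fun h => (h h15).elim
    · intro _ u v h
      omega
  · exact h.2.2.2.congr (fun x y => by simp) rfl rfl rfl rfl

end CliqueSearch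

/-! ### The main loop. -/

namespace CliqueSearch

open WordRAM Program Finset

variable {W n k M : ℕ} {e f : ℕ → ℕ → ℕ} {a b : List Move} {m : ℕ → ℕ}

/-- The final states with a right answer. -/
def Done (n k : ℕ) (e : ℕ → ℕ → ℕ) (s : State) : Prop :=
  s.reg 8 = 0 ∧ ((s.reg 0 = 0 ∧ ¬ ∃ f, Solves n k e f) ∨
    (s.reg 0 = 1 ∧ ∃ a, Config n k e a s ∧ Solves n k e (cnt a)))

/-- The invariant of the main loop. -/
def Running (n k M : ℕ) (e : ℕ → ℕ → ℕ) (a : List Move) (s : State) : Prop :=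
  s.reg 8 ≠ 0 ∧ Config n k e a s ∧ Search n k M e a

/-- A bound for the time of one step of the search. -/
def stepTime (n k : ℕ) : ℕ := n * (n * (k * 15 + 21) + 4) + 100

theorem halts_searchStep (hW : WordSize W n k M e)
    (hM : ∀ a, Valid n k e a → ∀ u < n, ∀ v < u, 0 < e u v → a.length + 1 ≤ M)
    (a : List Move) (s : State) (h : Running n k M e a s) :
    Halts W searchStep (stepTime n k) (fun s' => Done n k e s' ∨
      ∃ b, stepsFrom k M b < stepsFrom k M a ∧ Running n k M e b s') s := by
  obtain ⟨h8, hc, hse⟩ := h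
  have hlen := hse.length_le
  have hhead : ∀ t ∈ a.head?, t.slot ≤ k ∧ t.snd < t.fst ∧ t.fst < n := fun t ht => by
    cases a with
    | nil => simp at ht
    | cons t' b =>
      obtain rfl : t' = t := by simpa using ht
      exact ⟨hse.1.2.1, hse.1.2.2.1, hse.1.2.2.2.1⟩
  -- The number 58 bounds both `pop` and all that follows `scan`. With at most 39 for `test`, 2 from
  -- the scan and 1 for the branch this gives the 100 in `stepTime`.
  refine Halts.mono (T := test.cost + ((n * (n * (k * 15 + 21) + 4) + 2 + 58) + 1)) (Halts.seq
    (wp_test hW hc hlen hhead (Q := fun s' => Agree s s' ∧ s'.mem = s.mem ∧ s'.reg 15 = 0 ∧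
      (s'.reg 14 ≠ 0 ↔ Idle a) ∧ (s'.reg 13 ≠ 0 ↔ ∃ t ∈ a.head?, t.slot = k))
      fun s' h₁ h₂ h₃ h₄ h₅ => ⟨h₁, h₂, h₃, h₄, h₅⟩).halts
    fun s₁ ⟨ha₁, hm₁, h15, h14, h13⟩ => ?_) ?_ fun _ => id
  rotate_left
  · have : test.cost ≤ 39 := by decide
    unfold stepTime
    omega
  have hc₁ := hc.of_agree ha₁ hm₁
  have h8₁ : s₁.reg 8 ≠ 0 := by rwa [ha₁ 8 (by decide)]
  refine Halts.branch (fun hfull => ?_) (fun hfull => ?_)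
  · obtain ⟨t, ht, htk⟩ := h13.1 hfull
    have hpop : pop.cost ≤ 58 := by decide
    cases a with
    | nil => simp at ht
    | cons t' b =>
      obtain rfl : t' = t := by simpa using ht
      obtain ⟨ht', hv, hu⟩ := hhead _ ht
      refine Halts.mono (wp_pop hW hc₁ hlen ht' hv hu (fun t₂ b₂ hb => ?_)
        (fun s₂ hb h8₂ h0₂ => .inl ⟨h8₂, .inl ⟨h0₂, ?_⟩⟩)
        (fun s₂ t₂ b₂ hb h8₂ hc₂ => .inr ⟨_, ?_, by rwa [h8₂], hc₂, ?_⟩)).halts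
        (by omega) fun _ => id
      · have hval := hse.1.1
        rw [hb] at hval
        exact ⟨hval.2.1, hval.2.2.1, hval.2.2.2.1⟩
      · subst hb
        exact hse.not_solvable htk
      · subst hb
        exact stepsFrom_pop
      · subst hb
        exact hse.pop htk
  · have hslot : ∀ t ∈ a.head?, t.slot < k := fun t ht =>
      lt_of_le_of_ne (hhead t ht).1 fun heq => h13.2 ⟨t, ht, heq⟩ hfull
    have hcnt : ∀ i x, cnt a i x ≤ M := fun i x => (cnt_le_length a i x).trans hlen
    refine Halts.seq (T₁ := n * (n * (k * 15 + 21) + 4) + 2) (T₂ := 58) (halts_scan hW hcnt hc₁.regs hc₁.mem h14 h15) fun s₂ ⟨ha₂, hm₂, hsc⟩ => ?_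
    have hc₂ := hc₁.of_agree ha₂ hm₂
    have h8₂ : s₂.reg 8 ≠ 0 := by rwa [ha₂ 8 (by decide)]
    refine Halts.branch (T := 57) (fun hbad => ?_) (fun hbad => ?_)
    · have hb := hsc.bad.1 hbad
      have hbump : bump.cost ≤ 57 := by decide
      cases a with
      | nil =>
        -- The root is never rejected: there is no idle move and the empty family covers nothing.
        rcases hb with hb | ⟨u, v, -, hb⟩
        · exact hb.elim
        · simp [cov, cnt] at hb
      | cons t b =>
        obtain ⟨ht, hv, hu⟩ := hhead t rfl
        have hlt := hslot t rfl
        refine Halts.mono (wp_bump hW hc₂ hlen hlt hv hu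
          fun s₃ ha₃ hc₃ => .inr ⟨_, stepsFrom_fail hlt, ?_, hc₃, hse.fail hlt ?_⟩).halts
          hbump fun _ => id
        · rwa [ha₃ 8 (by decide)]
        · refine hb.imp id fun ⟨u, v, huv, hlt⟩ hfe => ?_
          exact absurd (hfe u huv.1 v huv.2) (by omega)
    · have hgood := (not_congr hsc.bad).1 (not_not.2 hbad)
      push Not at hgood
      obtain ⟨hidle, hfe⟩ := hgood
      have hval := hse.valid hslot hidle fun u hu v hv => hfe u v ⟨hu, hv⟩
      refine Halts.branch (T := 56) (fun hunc => ?_) (fun hunc => ?_)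
      · obtain ⟨hu, hv, hlt⟩ := hsc.found hunc
        -- The program never tests the depth. An undercovered pair has positive weight, so the depth
        -- bound for valid sequences leaves room for one more move.
        have hl := hM a hval _ hu _ hv (by omega)
        have hpush : push.cost ≤ 56 := by decide
        refine Halts.mono (wp_push hW hc₂ hl hv hu
          fun s₃ h8₃ hc₃ => .inr ⟨_, stepsFrom_push hslot hl, ?_, hc₃,
            hse.push hval hl hv hu hlt⟩).halts hpush fun _ => id
        rwa [h8₃]
      · refine Halts.mono (Program.wp.halts (P := .seq (.const 8 0) (.const 0 1)) ?_)
          (by decide) fun _ => id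
        have hL := hW.large
        have hr := hc₂.regs
        refine ⟨by omega, by omega, .inl ⟨by simp, .inr ⟨by simp, a, ⟨?_, ?_, hc₂.mem⟩, ?_⟩⟩⟩
        · constructor <;> simp only [State.setReg_reg, Nat.reduceEqDiff, if_false, OfNat.ofNat_ne_zero,
            one_ne_zero]
          exacts [hr.r1, hr.r2, hr.r3, hr.r4, hr.r6, hr.r7, hr.r27, hr.r28]
        · simpa using hc₂.sp
        · exact fun u hu v hv => le_antisymm (hfe u v ⟨hu, hv⟩) (hsc.covered hunc u v ⟨hu, hv⟩)

/-- The zeros after the matrix already encode the empty family, so only registers have to be set. -/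
theorem wp_init (hW : WordSize W n k M e) {s : State} (hr : ∀ r, s.reg r = 0)
    (h0 : s.mem 0 = n) (h1 : s.mem 1 = k)
    (hm : ∀ u < n, ∀ v < n, s.mem (u * n + 2 + v) = e u v)
    (hz : ∀ i ≤ k, ∀ u < n, s.mem (i * n + (n * n + 2) + u) = 0) :
    init.wp W (fun s' => s'.reg 8 ≠ 0 ∧ Config n k e [] s') s := by
  have hL := hW.large
  have hS : stackBase n k = k * n + n + (n * n + 2) := rfl
  simp only [init, Program.wp, State.setReg_reg, State.setReg_mem, if_true, if_false,
    Nat.reduceEqDiff, hr, h0, h1, add_zero]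
  refine ⟨by omega, by omega, by omega, by omega, by omega, by omega, by omega, by omega, by omega,
    by omega, by omega, by omega, by omega, ⟨?_, ?_, hm, hz, trivial⟩⟩
  · constructor <;> simp [hr, stackBase]
  · simp [stackBase]

theorem halts_main (hW : WordSize W n k M e)
    (hM : ∀ a, Valid n k e a → ∀ u < n, ∀ v < u, 0 < e u v → a.length + 1 ≤ M)
    {s : State} (hr : ∀ r, s.reg r = 0) (h0 : s.mem 0 = n) (h1 : s.mem 1 = k)
    (hm : ∀ u < n, ∀ v < n, s.mem (u * n + 2 + v) = e u v)
    (hz : ∀ i ≤ k, ∀ u < n, s.mem (i * n + (n * n + 2) + u) = 0) :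
    Halts W main (12 + ((treeSize k M + 1) * (stepTime n k + 1) + 1)) (Done n k e) s :=
  Halts.seq (wp_init hW hr h0 h1 hm hz).halts fun s' ⟨h8, hc⟩ =>
    Halts.loop_measure (stepsFrom k M) (fun _ _ h => h.1) (fun _ h => h.1)
      (halts_searchStep hW hM) [] s' ⟨h8, hc, Search.nil⟩

end CliqueSearch

/-! ## Instances -/

namespace WECP

open CliqueSearch Finset

variable (I : WECP)

/-- The weighted adjacency matrix on the natural numbers. -/
noncomputable def matrix (u v : ℕ) : ℕ :=
  if h : u < I.n ∧ v < I.n then I.entry ⟨u, h.1⟩ ⟨v, h.2⟩ else 0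

theorem matrix_val (u v : Fin I.n) : I.matrix u v = I.entry u v := by
  simp [matrix]

theorem entry_le (u v : Fin I.n) : I.entry u v ≤ I.maxWeight :=
  (le_sup (f := fun v => I.entry u v) (mem_univ v)).trans
    (le_sup (f := fun u => univ.sup fun v => I.entry u v) (mem_univ u))

theorem matrix_le (u v : ℕ) : I.matrix u v ≤ I.maxWeight := by
  unfold matrix
  split_ifs
  · exact I.entry_le _ _
  · exact Nat.zero_le _

theorem entry_pos_iff (u v : Fin I.n) : 0 < I.entry u v ↔ I.G.Adj u v := by
  unfold entry
  split_ifs with h <;> simp [h]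

theorem entry_comm (u v : Fin I.n) : I.entry u v = I.entry v u := by
  unfold entry
  by_cases h : I.G.Adj u v
  · rw [dif_pos h, dif_pos h.symm]
    congr 3
    exact Sym2.eq_swap
  · rw [dif_neg h, dif_neg fun h' => h h'.symm]

theorem cov_comm (k : ℕ) (f : ℕ → ℕ → ℕ) (u v : ℕ) : cov k f u v = cov k f v u := by
  simp only [cov, and_comm]

theorem cov_pos {k : ℕ} {f : ℕ → ℕ → ℕ} {u v i : ℕ} (hi : i < k) (hu : f i u ≠ 0)
    (hv : f i v ≠ 0) : 0 < cov k f u v :=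
  card_pos.2 ⟨i, mem_filter.2 ⟨mem_range.2 hi, hu, hv⟩⟩

variable {I}

/-- Two vertices of one set are covered at least once, so feasibility forces a positive entry, that
is, an edge. -/
theorem isClique_of_feasible {f : ℕ → ℕ → ℕ} (hf : Feasible I.n I.k I.matrix f) {i : ℕ}
    (hi : i < I.k) : I.G.IsClique {v : Fin I.n | f i v ≠ 0} := by
  have key : ∀ u v : Fin I.n, v < u → f i u ≠ 0 → f i v ≠ 0 → I.G.Adj u v :=
    fun u v hvu hu hv => by
      rw [← I.entry_pos_iff, ← I.matrix_val]
      exact (cov_pos hi hu hv).trans_le (hf u u.2 v hvu)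
  intro u hu v hv hne
  rcases lt_or_gt_of_ne hne with h | h
  · exact (key v u h hv hu).symm
  · exact key u v h hu hv

theorem card_filter_fin (q : ℕ) (p : ℕ → Prop) [DecidablePred p] :
    (univ.filter fun i : Fin q => p i).card = ((range q).filter p).card := by
  rw [← Nat.Iio_eq_range, ← Fin.map_valEmbedding_univ, filter_map, card_map]
  rfl

theorem card_fin_filter (q : ℕ) (f : ℕ → ℕ → ℕ) (u v : ℕ) :
    (univ.filter fun i : Fin q => f i u ≠ 0 ∧ f i v ≠ 0).card = cov q f u v :=
  card_filter_fin q fun i => f i u ≠ 0 ∧ f i v ≠ 0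

theorem isSolution_of_solves {f : ℕ → ℕ → ℕ} (hf : Solves I.n I.k I.matrix f) {q : ℕ}
    (hq : q = I.k) {C : Fin q → Finset (Fin I.n)} (hC : ∀ i v, v ∈ C i ↔ f i v ≠ 0) :
    I.IsSolution C := by
  subst hq
  refine ⟨le_rfl, fun i => ?_, fun u v h => ?_⟩
  · convert isClique_of_feasible (fun u hu v hv => (hf u hu v hv).le) i.2
    ext v
    simp [hC]
  · simp only [hC, card_fin_filter]
    have key : ∀ u v : Fin I.n, v < u → cov I.k f u v = I.entry u v := fun u v hvu => by
      rw [← I.matrix_val, hf u u.2 v hvu]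
    have he : I.entry u v = I.w ⟨s(u, v), h⟩ := by simp [entry, h]
    rw [← he]
    rcases lt_or_gt_of_ne h.ne with hlt | hlt
    · rw [cov_comm, I.entry_comm, key v u hlt]
    · exact key u v hlt

open Classical in
theorem IsSolution.exists_solves {q : ℕ} {C : Fin q → Finset (Fin I.n)} (h : I.IsSolution C) :
    ∃ f, Solves I.n I.k I.matrix f := by
  obtain ⟨hq, hcl, hw⟩ := h
  -- A family of fewer than `k` cliques is padded with empty sets.
  let f : ℕ → ℕ → ℕ := fun i x =>
    if h : i < q ∧ x < I.n then if ⟨x, h.2⟩ ∈ C ⟨i, h.1⟩ then 1 else 0 else 0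
  have hf : ∀ (i : Fin q) (v : Fin I.n), f i v ≠ 0 ↔ v ∈ C i := fun i v => by simp [f]
  have hcov : ∀ u v, cov I.k f u v = cov q f u v := fun u v => by
    unfold cov
    congr 1
    ext i
    simp only [mem_filter, mem_range]
    refine ⟨fun h => ⟨?_, h.2⟩, fun h => ⟨h.1.trans_le hq, h.2⟩⟩
    by_contra hi
    exact h.2.1 (by simp [f, hi])
  refine ⟨f, fun u hu v hvu => ?_⟩
  have hv := hvu.trans hu
  have hmat := I.matrix_val ⟨u, hu⟩ ⟨v, hv⟩
  simp only at hmat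
  have hcard := card_fin_filter q f u v
  have hf' : ∀ (i : Fin q), (f i u ≠ 0 ∧ f i v ≠ 0) ↔ ((⟨u, hu⟩ : Fin I.n) ∈ C i ∧ ⟨v, hv⟩ ∈ C i) :=
    fun i => and_congr (hf i ⟨u, hu⟩) (hf i ⟨v, hv⟩)
  simp only [hf'] at hcard
  rw [hcov, hmat, ← hcard]
  by_cases hadj : I.G.Adj ⟨u, hu⟩ ⟨v, hv⟩
  · rw [hw _ _ hadj]
    simp [entry, hadj]
  · have : I.entry ⟨u, hu⟩ ⟨v, hv⟩ = 0 := by simp [entry, hadj]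
    rw [this, card_eq_zero, filter_eq_empty_iff]
    intro i _ hi
    refine hadj (hcl i hi.1 hi.2 ?_)
    simp only [ne_eq, Fin.mk.injEq]
    omega

open Classical in
theorem size_le_β {a : List Move} (ha : Valid I.n I.k I.matrix a) {i : ℕ} (hi : i < I.k) :
    size I.n a i ≤ I.β := by
  have hcl : I.G.IsClique (univ.filter fun v : Fin I.n => cnt a i v ≠ 0 : Finset (Fin I.n)) := by
    convert isClique_of_feasible ha.feasible hi
    simp
  refine le_trans (le_of_eq ?_) hcl.card_le_cliqueNum
  exact (card_filter_fin I.n fun v => cnt a i v ≠ 0).symm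

theorem length_le {a : List Move} (ha : Valid I.n I.k I.matrix a) :
    a.length ≤ I.k * (I.β - 1) := by
  refine ha.length_le_sum.trans ?_
  refine (sum_le_card_nsmul _ _ (I.β - 1) fun i hi =>
    Nat.sub_le_sub_right (size_le_β ha (mem_range.1 hi)) 1).trans ?_
  simp

theorem β_le : I.β ≤ I.n := by
  obtain ⟨s, hs⟩ := I.G.exists_isNClique_cliqueNum
  rw [β, ← hs.card_eq]
  simpa using s.card_le_univ

theorem one_le_β (h : 0 < I.n) : 1 ≤ I.β := by
  have : I.G.IsClique (({⟨0, h⟩} : Finset (Fin I.n)) : Set (Fin I.n)) := by simp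
  simpa [β] using this.card_le_cliqueNum

theorem two_le_β {u v : Fin I.n} (h : I.G.Adj u v) : 2 ≤ I.β := by
  have : I.G.IsClique (({u, v} : Finset (Fin I.n)) : Set (Fin I.n)) := by
    simp [h]
  simpa [β, card_pair h.ne] using this.card_le_cliqueNum

end WECP

/-! ### Input, output and the final estimates. -/

namespace WECP

open CliqueSearch Finset

variable {I : WECP}

theorem input_matrix {u v : ℕ} (hu : u < I.n) (hv : v < I.n) :
    I.input.mem (u * I.n + 2 + v) = I.matrix u v := by
  have hn : 0 < I.n := by omega
  have hsub : u * I.n + 2 + v - 2 = I.n * u + v := by rw [mul_comm]; omega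
  have hdiv : (I.n * u + v) / I.n = u := by
    rw [Nat.mul_add_div hn, Nat.div_eq_of_lt hv, add_zero]
  have hmod : (I.n * u + v) % I.n = v := by rw [Nat.mul_add_mod, Nat.mod_eq_of_lt hv]
  have h₀ : ¬ u * I.n + 2 + v = 0 := by omega
  have h₁ : ¬ u * I.n + 2 + v = 1 := by omega
  simp only [input, h₀, h₁, if_false, hsub, hdiv, hmod, hu, hn, matrix, hv, and_self, dite_true]

theorem input_family {i u : ℕ} : I.input.mem (i * I.n + (I.n * I.n + 2) + u) = 0 := by
  have h₀ : ¬ i * I.n + (I.n * I.n + 2) + u = 0 := by omega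
  have h₁ : ¬ i * I.n + (I.n * I.n + 2) + u = 1 := by omega
  have h₂ : ¬ ((i * I.n + (I.n * I.n + 2) + u - 2) / I.n < I.n ∧ 0 < I.n) := fun ⟨h, hn⟩ => by
    rw [Nat.div_lt_iff_lt_mul hn] at h
    omega
  simp only [input, h₀, h₁, h₂, if_false, dite_false]

/-- Register 1 still holds `k`, so the output always consists of exactly `k` sets, some possibly
empty. -/
theorem isCorrectAnswer_of_done {s : WordRAM.State} (h : Done I.n I.k I.matrix s) :
    I.IsCorrectAnswer s := by
  rcases h.2 with ⟨h0, hno⟩ | ⟨h0, a, hc, hs⟩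
  · exact .inr ⟨h0, fun ⟨q, C, hC⟩ => hno hC.exists_solves⟩
  · refine .inl ⟨h0, isSolution_of_solves hs hc.regs.r1 fun i v => ?_⟩
    have hi : (i : ℕ) ≤ I.k := (i.2.trans_eq hc.regs.r1).le
    rw [← hc.mem.family i hi v v.2]
    simp [output, hc.regs.r2, add_comm, add_left_comm]

open Classical in
/-- A bound for the depth of the search. -/
noncomputable def depth (I : WECP) : ℕ :=
  if ∃ u v, I.G.Adj u v then I.k * (I.β - 1) + 1 else 0

theorem length_lt_depth {a : List Move} (ha : Valid I.n I.k I.matrix a) {u v : ℕ}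
    (he : 0 < I.matrix u v) : a.length + 1 ≤ I.depth := by
  have hadj : ∃ u v, I.G.Adj u v := by
    unfold matrix at he
    split_ifs at he with h
    · exact ⟨_, _, (I.entry_pos_iff _ _).1 he⟩
    · omega
  rw [depth, if_pos hadj]
  exact Nat.succ_le_succ (length_le ha)

theorem depth_le : I.depth ≤ I.k * I.n + 1 := by
  have := Nat.mul_le_mul_left I.k ((Nat.sub_le _ 1).trans (β_le (I := I)))
  unfold depth
  split_ifs <;> omega

theorem wordSize : WordSize ((I.n + I.k + I.maxWeight + 2) ^ 6) I.n I.k I.depth I.matrix := by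
  obtain ⟨N, hN⟩ : ∃ N, N = I.n + I.k + I.maxWeight + 2 := ⟨_, rfl⟩
  rw [← hN]
  have h2 : 2 ≤ N := by omega
  have hpow : N ^ 2 * 16 ≤ N ^ 6 := by
    calc N ^ 2 * 2 ^ 4 ≤ N ^ 2 * N ^ 4 := by gcongr
      _ = N ^ 6 := by ring
  constructor
  · have := depth_le (I := I)
    have h₁ : I.n * I.n ≤ N ^ 2 := by rw [sq]; exact Nat.mul_le_mul (by omega) (by omega)
    have h₂ : I.k * I.n ≤ N ^ 2 := by rw [sq]; exact Nat.mul_le_mul (by omega) (by omega)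
    have h₃ : 2 * N ≤ N ^ 2 := by rw [sq]; exact Nat.mul_le_mul_right _ h2
    unfold stackBase
    omega
  · intro u v
    have := I.matrix_le u v
    have h₃ : N ≤ N ^ 2 := Nat.le_self_pow (by decide) N
    omega

/-- The factor `n * k + 1` is the part of the time per node that depends on `k`; it must be absorbed
here, since `k` is not bounded in terms of `n`. -/
theorem treeSize_mul_le :
    (treeSize I.k I.depth + 1) * (I.n * I.k + 1) ≤ 16 * I.k ^ (I.β * I.k) * (I.n + 2) ^ 2 := by
  have hpos : 1 ≤ I.k ^ (I.β * I.k) := by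
    rcases Nat.eq_zero_or_pos I.k with h | h
    · simp [h]
    · exact Nat.one_le_pow _ _ h
  rcases Nat.eq_zero_or_pos I.n with hn | hn
  -- For `n = 0` also `β = 0` and the claimed time is independent of `k`, so the depth has to be 0
  -- rather than 1.
  · have : I.depth = 0 := by
      rw [depth, if_neg]
      rintro ⟨u, -⟩
      exact absurd u.2 (by omega)
    rw [this, hn]
    simp only [treeSize]
    omega
  have hβ := one_le_β hn
  have hkB : I.k ≤ I.k ^ (I.β * I.k) := by
    rcases Nat.eq_zero_or_pos I.k with h | h
    · omega
    · exact Nat.le_self_pow (Nat.mul_pos hβ h).ne' _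
  by_cases hadj : ∃ u v, I.G.Adj u v
  · rw [depth, if_pos hadj]
    obtain ⟨u, v, huv⟩ := hadj
    have hβ2 := two_le_β huv
    have hβn := β_le (I := I)
    rcases Nat.lt_or_ge I.k 2 with hk | hk
    · rcases (by omega : I.k = 0 ∨ I.k = 1) with hk | hk
      · have := treeSize_zero (0 * (I.β - 1) + 1)
        rw [hk, mul_zero, mul_zero, pow_zero]
        nlinarith
      · rw [hk, treeSize_one, one_pow]
        have : 2 * (1 * (I.β - 1) + 1) + 1 + 1 ≤ 2 * I.n + 2 := by omega
        nlinarith [Nat.mul_le_mul_right (I.n * 1 + 1) this]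
    · have h₁ := treeSize_le hk (I.k * (I.β - 1) + 1)
      have h₂ : I.n * I.k + 1 ≤ (I.n + 1) * I.k := by nlinarith
      -- One extra factor `k` is the rejected last level, the other the time per node; `k ≥ 2` pays
      -- for both.
      have h₃ : I.k * (I.β - 1) + 1 + 1 ≤ I.β * I.k := by
        obtain ⟨c, hc⟩ := Nat.exists_eq_add_of_le hβ2
        have : I.k * (I.β - 1) + I.k = I.β * I.k := by
          rw [show I.β - 1 = c + 1 by omega, hc]; ring
        omega
      calc (treeSize I.k (I.k * (I.β - 1) + 1) + 1) * (I.n * I.k + 1)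
          ≤ (3 * I.k ^ (I.k * (I.β - 1) + 1)) * ((I.n + 1) * I.k) :=
            Nat.mul_le_mul (by omega) h₂
        _ = 3 * (I.n + 1) * I.k ^ (I.k * (I.β - 1) + 1 + 1) := by ring
        _ ≤ 3 * (I.n + 1) * I.k ^ (I.β * I.k) :=
            Nat.mul_le_mul_left _ (Nat.pow_le_pow_right (by omega) h₃)
        _ = I.k ^ (I.β * I.k) * (3 * (I.n + 1)) := by ring
        _ ≤ I.k ^ (I.β * I.k) * (16 * (I.n + 2) ^ 2) := Nat.mul_le_mul_left _ (by nlinarith)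
        _ = _ := by ring
  · rw [depth, if_neg hadj]
    have : I.n * I.k ≤ I.n * I.k ^ (I.β * I.k) := Nat.mul_le_mul_left _ hkB
    calc (treeSize I.k 0 + 1) * (I.n * I.k + 1) = 2 * (I.n * I.k + 1) := rfl
      _ ≤ I.k ^ (I.β * I.k) * (2 * (I.n + 1)) := by linarith
      _ ≤ I.k ^ (I.β * I.k) * (16 * (I.n + 2) ^ 2) := Nat.mul_le_mul_left _ (by nlinarith)
      _ = _ := by ring

theorem time_le :
    12 + ((treeSize I.k I.depth + 1) * (stepTime I.n I.k + 1) + 1) ≤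
      I.k ^ (I.β * I.k) * (I.n + 2) ^ 15 := by
  have h := treeSize_mul_le (I := I)
  have h₁ : 13 + (stepTime I.n I.k + 1) ≤ (I.n * I.k + 1) * (128 * (I.n + 2) ^ 2) := by
    unfold stepTime
    nlinarith [Nat.zero_le (I.n * I.k * I.n * I.n), Nat.zero_le (I.n * I.k)]
  calc 12 + ((treeSize I.k I.depth + 1) * (stepTime I.n I.k + 1) + 1)
      ≤ (treeSize I.k I.depth + 1) * (13 + (stepTime I.n I.k + 1)) := by
        rw [mul_add _ 13]; omega
    _ ≤ (treeSize I.k I.depth + 1) * ((I.n * I.k + 1) * (128 * (I.n + 2) ^ 2)) :=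
        Nat.mul_le_mul_left _ h₁
    _ = (treeSize I.k I.depth + 1) * (I.n * I.k + 1) * (128 * (I.n + 2) ^ 2) := by ring
    _ ≤ 16 * I.k ^ (I.β * I.k) * (I.n + 2) ^ 2 * (128 * (I.n + 2) ^ 2) :=
        Nat.mul_le_mul_right _ h
    _ = I.k ^ (I.β * I.k) * (2 ^ 11 * (I.n + 2) ^ 4) := by ring
    -- Since `n + 2 ≥ 2`, constant factors turn into powers of `n + 2`.
    _ ≤ I.k ^ (I.β * I.k) * ((I.n + 2) ^ 11 * (I.n + 2) ^ 4) := by gcongr; omega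
    _ = I.k ^ (I.β * I.k) * (I.n + 2) ^ 15 := by ring

theorem two_rpow_mul_logb (b k : ℕ) :
    (2 : ℝ) ^ ((b : ℝ) * (k : ℝ) * Real.logb 2 (k : ℝ)) = (k : ℝ) ^ (b * k) := by
  rcases Nat.eq_zero_or_pos k with rfl | hk
  -- For `k = 0` both exponents vanish and both sides are 1.
  · simp
  · rw [mul_comm, Real.rpow_mul (by norm_num), Real.rpow_logb (by norm_num) (by norm_num)
      (by exact_mod_cast hk), ← Nat.cast_mul, Real.rpow_natCast]

end WECP

theorem theorem5 :
    ∃ (P : WordRAM.Program) (c d : ℕ), ∀ I : WECP,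
      ∃ (t : ℕ) (s : WordRAM.State),
        WordRAM.Run ((I.n + I.k + I.maxWeight + 2) ^ d) P I.input t s ∧
        I.IsCorrectAnswer s ∧
        (t : ℝ) ≤ (2 : ℝ) ^ ((I.β : ℝ) * (I.k : ℝ) * Real.logb 2 (I.k : ℝ)) *
          ((I.n : ℝ) + 2) ^ c := by
  refine ⟨CliqueSearch.main, 15, 6, fun I => ?_⟩
  obtain ⟨t, ht, s, hrun, hs⟩ := CliqueSearch.halts_main (I.wordSize)
    (fun a ha u _ v _ he => WECP.length_lt_depth ha he) (s := I.input) (fun _ => rfl) rfl rfl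
    (fun u hu v hv => WECP.input_matrix hu hv) (fun i _ u _ => WECP.input_family)
  refine ⟨t, s, hrun, WECP.isCorrectAnswer_of_done hs, ?_⟩
  rw [WECP.two_rpow_mul_logb]
  exact_mod_cast ht.trans WECP.time_le
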